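/- Let $R>0$, $mR>3/2$, $\mu=\sqrt{(mR)^2-9/4}$, and put $v(t,k)=t^{3/2}e^{-\mu\pi/2}H^{(1)}_{i\mu}(kt)$, with derivative $v'$ in $t$, and $W=v\bar v'-\bar v v'$. Let $\tilde f(\vec k)=(2\pi)^{-3/2}\int e^{-i\vec k\cdot\vec x}f(\vec x)\,d\vec x$, extended to tempered distributions. For real Cauchy data $(f,h)\in H^{1/2}(\mathbb R^3)\oplus H^{-1/2}(\mathbb R^3)$ let $K_t(f,h)\in L^2(\mathbb R^3)$ be $$K_t(f,h)(\vec k)=\frac{1}{t\,W(t,k)}\bigl(t\,\bar v'(t,k)\tilde f(\vec k)-R\,\bar v(t,k)\tilde h(\vec k)\bigr),\qquad k=|\vec k|,\qquad K=K_1 .$$ Let $U_0(t,s)=K_t^{-1}K_s$ be the free evolution, let $V(s)(f,h)=(0,V(s,\cdot)f)$ for a real (jointly measurable) potential $V(s,\vec x)$, and put $\hat U_0(t,s)=KU_0(t,s)K^{-1}$, $\hat V(s)=KV(s)K^{-1}$. **Theorem 1.** For every $R,m$ as above and every $C$ there is $\Lambda>0$, depending only on $R,m,C$, with the following property. Let $t\ge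 1$ and suppose that $\|\tilde V(s,\cdot)\|_{L^1(\mathbb R^3)}\le C$ for $1\le s\le t$, where $\tilde V(s,\cdot)$ is the spatial Fourier transform of $V(s,\cdot)$. Put $\Lambda_t=\Lambda t^3$. Then for $1\le s\le t$ the maps $K_s$ are well-defined bijections from the real Cauchy data onto $L^2(\mathbb R^3)$ and $V(s)$ maps the real Cauchy data to itself. The integrals in $$T_0\psi=\hat U_0(t,1)\psi,\qquad T_n\psi=(-1)^n\int_1^t\!\!\cdots\!\int_1^{s_{n-1}}\hat U_0(t,s_1)\hat V(s_1)\hat U_0(s_1,s_2)\cdots\hat V(s_n)\hat U_0(s_n,1)\psi\;ds_n\cdots ds_1\quad(n\ge1)$$ converge (as iterated Bochner integrals in $L^2(\mathbb R^3)$, for each $\psi\in L^2(\mathbb R^3)$) and define bounded real-linear operators on $L^2(\mathbb R^3)$ with $\|T_n\|\le\Lambda_t^{n+1}(t-1)^n/n!$. The Dyson series $\hat U_V(t,1)=\sum_{n\ge0}T_n$ for the conjugated perturbed evolution $\hat U_V(t,1)=KU_V(t,1)K^{-1}$ converges in operator norm on $L^2(\mathbb R^3)$, and $$\|\hat U_V(t,1)\|\le\Lambda_t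 e^{\Lambda_t(t-1)} .$$ -/

import Mathlib

open MeasureTheory FourierTransform TemperedDistribution
open scoped SchwartzMap ENNReal

noncomputable section

namespace DeSitter

/-- Three-dimensional Euclidean space, used both for positions and for momenta. -/
abbrev R3 : Type := EuclideanSpace ℝ (Fin 3)

/-- The Hilbert space `L²(ℝ³)` of complex functions. -/
abbrev L2 : Type := Lp ℂ 2 (volume : Measure R3)

/-! ### Mode functions -/

/-- The Bessel function `J_ν(x) = ∑ (-1)ⁿ / (n! Γ(n+ν+1)) (x/2)^(ν+2n)`. -/
def besselJ (ν : ℂ) (x : ℝ) : ℂ :=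
  ∑' n : ℕ, (-1 : ℂ) ^ n / ((n.factorial : ℂ) * Complex.Gamma (n + ν + 1)) *
    ((x / 2 : ℝ) : ℂ) ^ (ν + 2 * (n : ℂ))

/-- The Hankel function of the first kind,
`H_ν⁽¹⁾(x) = (J_{-ν}(x) - e^{-iπν} J_ν(x)) / (i sin(νπ))`, for non-integral `ν`. -/
def hankel1 (ν : ℂ) (x : ℝ) : ℂ :=
  (besselJ (-ν) x - Complex.exp (-(Complex.I * Real.pi * ν)) * besselJ ν x) /
    (Complex.I * Complex.sin (ν * Real.pi))

/-- `μ = √((mR)² - 9/4)`; the index of the Hankel functions is `ν = iμ`. -/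
def indexMu (R m : ℝ) : ℝ := Real.sqrt ((m * R) ^ 2 - 9 / 4)

/-- The mode function `v(t,k) = t^{3/2} e^{-μπ/2} H_{iμ}⁽¹⁾(kt)`. -/
def mode (R m t k : ℝ) : ℂ :=
  ((t ^ (3 / 2 : ℝ) : ℝ) : ℂ) * ((Real.exp (-(indexMu R m * Real.pi / 2)) : ℝ) : ℂ) *
    hankel1 (Complex.I * (indexMu R m : ℂ)) (k * t)

/-- The time derivative `v'(t,k)`. -/
def modeDeriv (R m t k : ℝ) : ℂ := deriv (fun τ : ℝ => mode R m τ k) t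

/-- The complex conjugate mode function. -/
def modeBar (R m t k : ℝ) : ℂ := starRingEnd ℂ (mode R m t k)

/-- The time derivative of the complex conjugate mode function. -/
def modeBarDeriv (R m t k : ℝ) : ℂ := starRingEnd ℂ (modeDeriv R m t k)

/-- The Wronskian `W(t,k)` of `v` and its complex conjugate. -/
def wronskian (R m t k : ℝ) : ℂ :=
  Matrix.det !![mode R m t k, modeBar R m t k; modeDeriv R m t k, modeBarDeriv R m t k]

/-! ### Fourier transforms and real Cauchy data -/

/-- The tempered distribution `T` is given by the function `u`. -/
def RepresentedBy (T : 𝓢'(R3, ℂ)) (u : R3 → ℂ) : Prop :=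
  ∀ φ : 𝓢(R3, ℂ), Integrable (fun x => u x * φ x) ∧ T φ = ∫ x, u x * φ x

/-- The Fourier transform of the tempered distribution `T`, in the normalization
`(2π)^{-3/2} ∫ e^{-ik·x} T(x) dx`, is the function `g`. Mathlib's Fourier transform is
`∫ e^{-2πiξ·x} T(x) dx`, whence the rescaling. -/
def HasFourierTransform (T : 𝓢'(R3, ℂ)) (g : R3 → ℂ) : Prop :=
  RepresentedBy (𝓕 T)
    (fun ξ => (((2 * Real.pi) ^ (3 / 2 : ℝ) : ℝ) : ℂ) * g ((2 * Real.pi) • ξ))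

/-- The (distributional) Fourier transform of the real function `V` is the function `g`. -/
def FunHasFourierTransform (V : R3 → ℝ) (g : R3 → ℂ) : Prop :=
  ∃ T : 𝓢'(R3, ℂ), RepresentedBy T (fun x => (V x : ℂ)) ∧ HasFourierTransform T g

/-- A tempered distribution is real if it is real on real test functions. -/
def IsRealDist (T : 𝓢'(R3, ℂ)) : Prop :=
  ∀ φ : 𝓢(R3, ℂ), (∀ x, (φ x).im = 0) → (T φ).im = 0

/-- The real vector space of real Cauchy data `(f, h)` in `H^{1/2}(ℝ³) ⊕ H^{-1/2}(ℝ³)`. -/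
def CauchyData : Submodule ℝ (𝓢'(R3, ℂ) × 𝓢'(R3, ℂ)) where
  carrier := {D | MemSobolev (1 / 2) 2 D.1 ∧ MemSobolev (-1 / 2) 2 D.2 ∧
    IsRealDist D.1 ∧ IsRealDist D.2}
  add_mem' := by
    rintro D D' ⟨h1, h2, h3, h4⟩ ⟨h1', h2', h3', h4'⟩
    refine ⟨h1.add h1', h2.add h2', fun φ hφ => ?_, fun φ hφ => ?_⟩
    · have e : (D + D').1 φ = D.1 φ + D'.1 φ := rfl
      rw [e, Complex.add_im, h3 φ hφ, h3' φ hφ, add_zero]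
    · have e : (D + D').2 φ = D.2 φ + D'.2 φ := rfl
      rw [e, Complex.add_im, h4 φ hφ, h4' φ hφ, add_zero]
  zero_mem' := ⟨memSobolev_fun_zero _ _ _ _, memSobolev_fun_zero _ _ _ _, fun _ _ => rfl, fun _ _ => rfl⟩
  smul_mem' := by
    rintro c D ⟨h1, h2, h3, h4⟩
    have e1 : (c • D).1 = (c : ℂ) • D.1 := by ext φ; rfl
    have e2 : (c • D).2 = (c : ℂ) • D.2 := by ext φ; rfl
    refine ⟨e1 ▸ h1.smul _, e2 ▸ h2.smul _, fun φ hφ => ?_, fun φ hφ => ?_⟩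
    · have e : (c • D).1 φ = c • D.1 φ := rfl
      rw [e, Complex.smul_im, h3 φ hφ, smul_zero]
    · have e : (c • D).2 φ = c • D.2 φ := rfl
      rw [e, Complex.smul_im, h4 φ hφ, smul_zero]

/-! ### The maps `K_t` and the operators -/

/-- `ψ = K_t(f,h)`: almost everywhere
`ψ(k) = (t W(t,k))⁻¹ det [[f̃(k), v̄(t,k)], [R h̃(k), t v̄'(t,k)]]`. -/
def IsCoefficient (R m t : ℝ) (D : CauchyData) (ψ : L2) : Prop :=
  ∃ a b : R3 → ℂ, HasFourierTransform D.1.1 a ∧ HasFourierTransform D.1.2 b ∧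
    ∀ᵐ k : R3, ψ k = 1 / ((t : ℂ) * wronskian R m t ‖k‖) *
      Matrix.det !![a k, modeBar R m t ‖k‖; (R : ℂ) * b k, (t : ℂ) * modeBarDeriv R m t ‖k‖]

/-- The map `K_t` from real Cauchy data at time `t` to the coefficient `ψ ∈ L²(ℝ³)`. -/
def coefficientMap (R m t : ℝ) (D : CauchyData) : L2 :=
  Classical.epsilon fun ψ : L2 => IsCoefficient R m t D ψ

/-- The inverse map `K_t⁻¹`. -/
def coefficientInv (R m t : ℝ) : L2 → CauchyData := Function.invFun (coefficientMap R m t)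

/-- The free evolution `U₀(t,s) = K_t⁻¹ K_s` of Cauchy data. -/
def freeEvolution (R m t s : ℝ) (D : CauchyData) : CauchyData :=
  coefficientInv R m t (coefficientMap R m s D)

/-- `D' = (0, V f)` where `D = (f, h)`. -/
def IsPotentialImage (V : R3 → ℝ) (D D' : CauchyData) : Prop :=
  D'.1.1 = 0 ∧ ∃ u : R3 → ℂ, RepresentedBy D.1.1 u ∧
    RepresentedBy D'.1.2 (fun x => (V x : ℂ) * u x)

/-- The perturbation `(f, h) ↦ (0, V f)`. -/
def potentialMap (V : R3 → ℝ) (D : CauchyData) : CauchyData :=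
  Classical.epsilon fun D' : CauchyData => IsPotentialImage V D D'

/-- `Û₀(t,s) = K U₀(t,s) K⁻¹` with `K = K₁`. -/
def freeHat (R m t s : ℝ) (ψ : L2) : L2 :=
  coefficientMap R m 1 (freeEvolution R m t s (coefficientInv R m 1 ψ))

/-- `V̂(s) = K V(s) K⁻¹` with `K = K₁`. -/
def potentialHat (R m : ℝ) (V : ℝ → R3 → ℝ) (s : ℝ) (ψ : L2) : L2 :=
  coefficientMap R m 1 (potentialMap (V s) (coefficientInv R m 1 ψ))

/-! ### The Dyson series -/

/-- The iterated integral
`∫₁ˢ ∫₁^{s₁} ⋯ ∫₁^{s_{n-1}} A Û₀(s,s₁) V̂(s₁) Û₀(s₁,s₂) ⋯ V̂(s_n) Û₀(s_n,1) ψ ds_n ⋯ ds₁`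
of vectors of `L²(ℝ³)` (Bochner integrals); for `n = 0` it is `A Û₀(s,1) ψ`. -/
def dysonIntegral (R m : ℝ) (V : ℝ → R3 → ℝ) (ψ : L2) : ℕ → (L2 → L2) → ℝ → L2
  | 0, A, s => A (freeHat R m s 1 ψ)
  | n + 1, A, s => ∫ r in (1 : ℝ)..s,
      dysonIntegral R m V ψ n (fun χ => A (freeHat R m s r (potentialHat R m V r χ))) r

/-- Every one of the integrals that occur in `dysonIntegral` is a convergent Bochner integral. -/
def DysonIntegrable (R m : ℝ) (V : ℝ → R3 → ℝ) (ψ : L2) : ℕ → (L2 → L2) → ℝ → Prop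
  | 0, _, _ => True
  | n + 1, A, s =>
      IntervalIntegrable (fun r : ℝ => dysonIntegral R m V ψ n
        (fun χ => A (freeHat R m s r (potentialHat R m V r χ))) r) volume 1 s ∧
      ∀ r ∈ Set.Icc 1 s, DysonIntegrable R m V ψ n
        (fun χ => A (freeHat R m s r (potentialHat R m V r χ))) r

/-- The `n`-th term of the Dyson series for `Û_V(t,1)`, applied to `ψ`. -/
def dysonTerm (R m : ℝ) (V : ℝ → R3 → ℝ) (n : ℕ) (t : ℝ) (ψ : L2) : L2 :=
  (-1 : ℝ) ^ n • dysonIntegral R m V ψ n id t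

end DeSitter

end

/-! In momentum space the free problem is diagonal up to the reflection `k ↦ -k`. Data at time `s`
with coefficient `ψ` have Fourier transforms `v ψ + v̄ ψ*` and `R⁻¹ s (v' ψ + v̄' ψ*)`, where
`ψ*(k)` is the conjugate of `ψ(-k)`. Reality of the data is the symmetry that makes this a 2×2
system for `ψ` and `ψ*`. Its determinant is a multiple of `W`, so `K_s` is Cramer's rule, and `K_r
K_s⁻¹` has the form `ψ ↦ a ψ + b ψ*` with explicit multipliers.

Everything then rests on the size of Hankel functions of index `iμ`. With `L = x H'`, two monotone
energies, one on `(0,1]` and one on `[1,∞)`, give `|H| ≤ c (1+x²)^{-1/4}` and `|L| ≤ c (1+x²)^{1/4}`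
(`IsBesselPair.exists_bound`). The quantity `H L̄ - H̄ L` is a nonzero constant, whence `W(t,k) = t²
w` with `w ≠ 0` (`exists_wronskian_eq`). The weights match those of `H^{1/2}` and `H^{-1/2}`, which
makes `K_s` a bijection onto `L²`. They cancel in products of `v` and `v'`, which leaves `‖K_r
K_s⁻¹‖ ≤ c s²` for all `r, s ≥ 1` (`exists_norm_transOp_le`).

A potential with integrable Fourier transform is bounded (`FunHasFourierTransform.ae_norm_le`), and
`H^{1/2} ⊂ L² ⊂ H^{-1/2}`, so `V̂(s)` is bounded by a constant `b` depending on `R, m, C` only.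

Finally `Û₀(s,r) = (K K_s⁻¹)(K_r K⁻¹)` splits into a factor in `s` of norm at most `c t²` and a
factor in `r` of norm at most `c`. The `n`-th term is therefore at most `(c² t²)^{n+1} bⁿ` times the
volume `(t-1)ⁿ/n!` of the simplex, and `Λ = c²(1+b)` suffices because `t ≥ 1`. Measurability of the
integrands is obtained weakly, by testing against vectors (`aestronglyMeasurable_of_inner`). -/

noncomputable section

namespace DeSitter

/-! ### Power series with factorially decaying coefficients -/

section EntireSeries

variable {c : ℕ → ℂ} {M : ℝ}

theorem norm_coeff_mul_pow_le (hc : ∀ n, ‖c n‖ ≤ M / n.factorial) {r : ℝ} {z : ℂ} (hz : ‖z‖ ≤ r)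
    (n : ℕ) : ‖c n * z ^ n‖ ≤ M * (r ^ n / n.factorial) := by
  rw [norm_mul, norm_pow]
  calc ‖c n‖ * ‖z‖ ^ n ≤ M / n.factorial * r ^ n :=
        mul_le_mul (hc n) (pow_le_pow_left₀ (norm_nonneg _) hz n) (by positivity)
          ((norm_nonneg _).trans (hc n))
    _ = _ := by ring

theorem summable_coeff_mul_pow (hc : ∀ n, ‖c n‖ ≤ M / n.factorial) (z : ℂ) :
    Summable fun n => c n * z ^ n :=
  .of_norm_bounded ((Real.summable_pow_div_factorial ‖z‖).mul_left M)
    (norm_coeff_mul_pow_le hc le_rfl)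

theorem hasDerivAt_tsum_coeff_mul_pow (hc : ∀ n, ‖c n‖ ≤ M / n.factorial) (z : ℂ) :
    HasDerivAt (fun w => ∑' n, c n * w ^ n) (∑' n : ℕ, ((n + 1 : ℂ) * c (n + 1)) * z ^ n) z := by
  have hu := (Real.summable_pow_div_factorial (‖z‖ + 1)).mul_left M
  have hb : ∀ (n : ℕ) (w : ℂ), w ∈ Metric.ball (0 : ℂ) (‖z‖ + 1) →
      ‖c n * w ^ n‖ ≤ M * ((‖z‖ + 1) ^ n / n.factorial) := fun n w hw =>
    norm_coeff_mul_pow_le hc (by simpa using (mem_ball_zero_iff.1 hw).le) n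
  have hd : ∀ n : ℕ, DifferentiableOn ℂ (fun w : ℂ => c n * w ^ n) (Metric.ball 0 (‖z‖ + 1)) :=
    fun n => by fun_prop
  have hz : z ∈ Metric.ball (0 : ℂ) (‖z‖ + 1) := by simp
  have h1 := Complex.differentiableOn_tsum_of_summable_norm hu hd Metric.isOpen_ball hb
  have h2 := Complex.hasSum_deriv_of_summable_norm hu hd Metric.isOpen_ball hb hz
  have h3 := (h1.differentiableAt (Metric.isOpen_ball.mem_nhds hz)).hasDerivAt
  rw [← h2.tsum_eq, h2.summable.tsum_eq_zero_add] at h3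
  refine h3.congr_deriv ?_
  simp only [deriv_const_mul_field, deriv_pow_field, pow_zero, deriv_const, mul_zero, zero_add]
  refine tsum_congr fun n => ?_
  simp
  ring

/-- The factor `n + 1` is absorbed by the factorial, so the same `M` serves for the derived series
and termwise differentiation can be iterated. -/
theorem norm_deriv_coeff_le (hc : ∀ n, ‖c n‖ ≤ M / n.factorial) (n : ℕ) :
    ‖(n + 1 : ℂ) * c (n + 1)‖ ≤ M / n.factorial := by
  have h := hc (n + 1)
  rw [Nat.factorial_succ] at h
  push_cast at h
  have e : ‖(n + 1 : ℂ)‖ = n + 1 := by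
    rw [← Nat.cast_succ, Complex.norm_natCast]; push_cast; rfl
  rw [norm_mul, e]
  calc (n + 1 : ℝ) * ‖c (n + 1)‖ ≤ (n + 1) * (M / ((n + 1) * n.factorial)) := by gcongr
    _ = _ := by field_simp

end EntireSeries

/-! ### The Bessel function of imaginary index -/

/-- The coefficients of `(x/2)^{-ν} J_ν(x)` as a power series in `x²/4`. -/
def besselCoeff (ν : ℂ) (n : ℕ) : ℂ :=
  (-1 : ℂ) ^ n / ((n.factorial : ℂ) * Complex.Gamma (n + ν + 1))

theorem natCast_add_add_one_ne_zero {ν : ℂ} (hν : 0 ≤ ν.re) (n : ℕ) : (n + ν + 1 : ℂ) ≠ 0 := by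
  intro h
  have := congrArg Complex.re h
  simp at this
  have : (0 : ℝ) ≤ n := n.cast_nonneg
  linarith

theorem besselCoeff_succ {ν : ℂ} (hν : 0 ≤ ν.re) (n : ℕ) :
    (n + 1 : ℂ) * (n + ν + 1) * besselCoeff ν (n + 1) = -besselCoeff ν n := by
  have h0 := natCast_add_add_one_ne_zero hν n
  have hG : Complex.Gamma (n + ν + 1) ≠ 0 := by
    apply Complex.Gamma_ne_zero_of_re_pos
    simp
    have : (0 : ℝ) ≤ n := n.cast_nonneg
    linarith
  have h1 : ((n + 1 : ℕ) : ℂ) + ν + 1 = (n + ν + 1) + 1 := by push_cast; ring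
  have hf : (n.factorial : ℂ) ≠ 0 := by exact_mod_cast n.factorial_ne_zero
  have hn : (n + 1 : ℂ) ≠ 0 := by exact_mod_cast n.succ_ne_zero
  unfold besselCoeff
  rw [h1, Complex.Gamma_add_one _ h0, Nat.factorial_succ]
  push_cast
  field_simp
  ring

/-- The two-term recurrence together with `|n + ν + 1| ≥ 1` gives the factorial decay; no estimate
of the Gamma function is needed. -/
theorem norm_besselCoeff_le {ν : ℂ} (hν : 0 ≤ ν.re) (n : ℕ) :
    ‖besselCoeff ν n‖ ≤ ‖besselCoeff ν 0‖ / n.factorial := by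
  induction n with
  | zero => simp
  | succ n ih =>
    have h := congrArg norm (besselCoeff_succ hν n)
    have e : ‖(n + 1 : ℂ)‖ = n + 1 := by
      rw [← Nat.cast_succ, Complex.norm_natCast]; push_cast; rfl
    rw [norm_mul, norm_mul, norm_neg, e] at h
    have h1 : (1 : ℝ) ≤ ‖(n + ν + 1 : ℂ)‖ := by
      refine le_trans ?_ (Complex.re_le_norm _)
      simp
      positivity
    rw [Nat.factorial_succ, Nat.cast_mul, le_div_iff₀ (by positivity)]
    rw [le_div_iff₀ (by positivity)] at ih
    refine le_trans ?_ ih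
    rw [← h]
    push_cast
    have : 0 ≤ ‖besselCoeff ν (n + 1)‖ * n.factorial * (n + 1) := by positivity
    nlinarith

/-- The entire function `G` with `J_ν(x) = (x/2)^ν G(x²/4)`. -/
def besselEntire (ν z : ℂ) : ℂ := ∑' n, besselCoeff ν n * z ^ n

/-- The derivative of `besselEntire ν`. -/
def besselEntireDeriv (ν z : ℂ) : ℂ := ∑' n : ℕ, ((n + 1 : ℂ) * besselCoeff ν (n + 1)) * z ^ n

theorem hasDerivAt_besselEntire {ν : ℂ} (hν : 0 ≤ ν.re) (z : ℂ) :
    HasDerivAt (besselEntire ν) (besselEntireDeriv ν z) z :=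
  hasDerivAt_tsum_coeff_mul_pow (norm_besselCoeff_le hν) z

/-- The recurrence for the coefficients is, power by power, the equation `z G'' + (1 + ν) G' + G =
0`, which is Bessel's equation in the variable `z = x²/4`. -/
theorem exists_hasDerivAt_besselEntireDeriv {ν : ℂ} (hν : 0 ≤ ν.re) (z : ℂ) :
    ∃ d, HasDerivAt (besselEntireDeriv ν) d z ∧
      z * d + (1 + ν) * besselEntireDeriv ν z + besselEntire ν z = 0 := by
  have hb := norm_besselCoeff_le hν
  have hb1 := norm_deriv_coeff_le hb
  refine ⟨_, hasDerivAt_tsum_coeff_mul_pow hb1 z, ?_⟩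
  have s0 := summable_coeff_mul_pow hb z
  have s1 := summable_coeff_mul_pow hb1 z
  have s2 := summable_coeff_mul_pow (norm_deriv_coeff_le hb1) z
  have e : z * ∑' n : ℕ, ((n + 1 : ℂ) * (((n + 1 : ℕ) + 1 : ℂ) * besselCoeff ν (n + 1 + 1))) * z ^ n
      = ∑' n : ℕ, ((n : ℂ) * ((n + 1 : ℂ) * besselCoeff ν (n + 1))) * z ^ n ∧
      Summable fun n : ℕ => ((n : ℂ) * ((n + 1 : ℂ) * besselCoeff ν (n + 1))) * z ^ n := by
    have hs : Summable fun n : ℕ => ((n : ℂ) * ((n + 1 : ℂ) * besselCoeff ν (n + 1))) * z ^ n := by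
      rw [← summable_nat_add_iff 1]
      refine (s2.mul_left z).congr fun n => ?_
      push_cast
      ring
    refine ⟨?_, hs⟩
    rw [hs.tsum_eq_zero_add, ← tsum_mul_left]
    simp only [Nat.cast_zero, zero_mul, zero_add]
    congr 1
    ext n
    push_cast
    ring
  rw [e.1, besselEntireDeriv, besselEntire, ← tsum_mul_left, ← e.2.tsum_add (s1.mul_left _),
    ← (e.2.add (s1.mul_left _)).tsum_add s0]
  refine (tsum_congr fun n => ?_).trans tsum_zero
  have := besselCoeff_succ hν n
  linear_combination z ^ n * this

theorem besselJ_eq (ν : ℂ) {x : ℝ} (hx : 0 < x) :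
    besselJ ν x = ((x / 2 : ℝ) : ℂ) ^ ν * besselEntire ν ((x ^ 2 / 4 : ℝ) : ℂ) := by
  have h2 : ((x / 2 : ℝ) : ℂ) ≠ 0 := by
    exact_mod_cast (half_pos hx).ne'
  unfold besselJ besselEntire
  rw [← tsum_mul_left]
  refine tsum_congr fun n => ?_
  rw [Complex.cpow_add _ _ h2, besselCoeff]
  have : ((x / 2 : ℝ) : ℂ) ^ (2 * (n : ℂ)) = ((x ^ 2 / 4 : ℝ) : ℂ) ^ n := by
    rw [show (2 * (n : ℂ)) = ((2 * n : ℕ) : ℂ) by push_cast; ring, Complex.cpow_natCast, pow_mul]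
    congr 1
    push_cast
    ring
  rw [this]
  ring

/-- For `ν = iμ` this identifies `J_{-iμ}` with the conjugate of `J_{iμ}`, so one index suffices.
The power commutes with conjugation because its base `x/2` is off the branch cut. -/
theorem besselJ_conj (ν : ℂ) {x : ℝ} (hx : 0 < x) :
    besselJ (starRingEnd ℂ ν) x = starRingEnd ℂ (besselJ ν x) := by
  unfold besselJ
  rw [Complex.conj_tsum]
  refine tsum_congr fun n => ?_
  have harg : ((x / 2 : ℝ) : ℂ).arg ≠ Real.pi := by
    rw [Complex.arg_ofReal_of_nonneg (by positivity)]
    exact Real.pi_ne_zero.symm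
  have h := Complex.cpow_conj ((x / 2 : ℝ) : ℂ) (ν + 2 * n) harg
  simp only [Complex.conj_ofReal, map_add, map_mul, map_natCast, Complex.conj_ofNat] at h
  rw [h]
  simp [← Complex.Gamma_conj]

/-- `x J_ν'(x)`. -/
def besselJTheta (ν : ℂ) (x : ℝ) : ℂ :=
  ((x / 2 : ℝ) : ℂ) ^ ν * (ν * besselEntire ν ((x ^ 2 / 4 : ℝ) : ℂ) +
    ((x ^ 2 / 2 : ℝ) : ℂ) * besselEntireDeriv ν ((x ^ 2 / 4 : ℝ) : ℂ))

theorem hasDerivAt_half_cpow (ν : ℂ) {x : ℝ} (hx : 0 < x) :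
    HasDerivAt (fun y : ℝ => ((y / 2 : ℝ) : ℂ) ^ ν) (((x / 2 : ℝ) : ℂ) ^ ν * ν / x) x := by
  have h2 : ((x / 2 : ℝ) : ℂ) ∈ Complex.slitPlane := by
    rw [Complex.ofReal_mem_slitPlane]; positivity
  have h0 : HasDerivAt (fun y : ℝ => ((y / 2 : ℝ) : ℂ)) ((1 / 2 : ℝ) : ℂ) x :=
    ((hasDerivAt_id x).div_const 2).ofReal_comp
  have h : HasDerivAt (fun y : ℝ => ((y / 2 : ℝ) : ℂ) ^ ν) _ x :=
    HasDerivAt.comp (h₂ := fun z : ℂ => z ^ ν) x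
      ((hasDerivAt_id ((x / 2 : ℝ) : ℂ)).cpow_const (c := ν) h2) h0
  refine h.congr_deriv ?_
  simp only [id]
  have hx' : (x : ℂ) ≠ 0 := by exact_mod_cast hx.ne'
  rw [Complex.cpow_sub _ _ (Complex.slitPlane_ne_zero h2), Complex.cpow_one]
  push_cast
  field_simp

theorem hasDerivAt_sq_div_four (x : ℝ) :
    HasDerivAt (fun y : ℝ => ((y ^ 2 / 4 : ℝ) : ℂ)) ((x / 2 : ℝ) : ℂ) x := by
  have h : HasDerivAt (fun y : ℝ => y ^ 2 / 4) (x / 2) x := by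
    refine ((hasDerivAt_pow 2 x).div_const 4).congr_deriv ?_
    push_cast
    ring
  exact h.ofReal_comp

/-- `H` solves Bessel's equation of index `iμ` on `(0,∞)` and `L(x) = x H'(x)`. -/
def IsBesselPair (μ : ℝ) (H L : ℝ → ℂ) : Prop :=
  ∀ x : ℝ, 0 < x → HasDerivAt H (L x / x) x ∧
    HasDerivAt L (-((μ ^ 2 + x ^ 2 : ℝ) : ℂ) * H x / x) x

theorem isBesselPair_besselJ (μ : ℝ) :
    IsBesselPair μ (besselJ (Complex.I * μ)) (besselJTheta (Complex.I * μ)) := by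
  intro x hx
  set ν : ℂ := Complex.I * μ with hν
  have hre : 0 ≤ ν.re := by simp [hν]
  have hx' : (x : ℂ) ≠ 0 := by exact_mod_cast hx.ne'
  have hp := hasDerivAt_half_cpow ν hx
  have hG : HasDerivAt (fun y : ℝ => besselEntire ν ((y ^ 2 / 4 : ℝ) : ℂ)) _ x :=
    (hasDerivAt_besselEntire hre _).comp x (hasDerivAt_sq_div_four x)
  obtain ⟨d, hd, hode⟩ := exists_hasDerivAt_besselEntireDeriv hre ((x ^ 2 / 4 : ℝ) : ℂ)
  have hG' : HasDerivAt (fun y : ℝ => besselEntireDeriv ν ((y ^ 2 / 4 : ℝ) : ℂ))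
      (d * ((x / 2 : ℝ) : ℂ)) x :=
    HasDerivAt.comp (h₂ := besselEntireDeriv ν) x hd (hasDerivAt_sq_div_four x)
  have hsq : HasDerivAt (fun y : ℝ => ((y ^ 2 / 2 : ℝ) : ℂ)) (x : ℂ) x := by
    have h : HasDerivAt (fun y : ℝ => y ^ 2 / 2) x x := by
      refine ((hasDerivAt_pow 2 x).div_const 2).congr_deriv ?_
      push_cast
      ring
    exact h.ofReal_comp
  have hI : ν ^ 2 = -(μ : ℂ) ^ 2 := by
    rw [hν, mul_pow, Complex.I_sq]; ring
  clear_value ν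
  constructor
  · have h := hp.mul hG
    refine (h.congr_of_eventuallyEq ?_).congr_deriv ?_
    · filter_upwards [lt_mem_nhds hx] with y hy
      exact besselJ_eq ν hy
    · unfold besselJTheta
      push_cast
      field_simp
  · have h := hp.mul ((hG.const_mul ν).add (hsq.mul hG'))
    refine (h.congr_of_eventuallyEq (.of_forall fun y => rfl)).congr_deriv ?_
    rw [besselJ_eq ν hx]
    push_cast at hode ⊢
    simp only [Pi.mul_apply, Pi.add_apply]
    field_simp
    ring_nf at hode ⊢
    linear_combination ((x : ℂ) * (1 / 2)) ^ ν * (4 * x ^ 2) * hode +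
      4 * ((x : ℂ) * (1 / 2)) ^ ν * besselEntire ν (x ^ 2 * (1 / 4)) * hI

/-! ### Bounds for solutions of Bessel's equation -/

/-- The weight `(1 + x²)^{1/4}`. -/
def jap (x : ℝ) : ℝ := (1 + x ^ 2) ^ (1 / 4 : ℝ)

theorem jap_pos (x : ℝ) : 0 < jap x := Real.rpow_pos_of_pos (by positivity) _

theorem jap_sq (x : ℝ) : jap x ^ 2 = √(1 + x ^ 2) := by
  rw [jap, ← Real.rpow_natCast, ← Real.rpow_mul (by positivity), Real.sqrt_eq_rpow]
  norm_num

theorem continuous_jap : Continuous jap :=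
  Continuous.rpow_const (by fun_prop) fun x => .inl (by positivity)

theorem jap_le_jap_mul {k t : ℝ} (ht : 1 ≤ t) : jap k ≤ jap (k * t) := by
  refine Real.rpow_le_rpow (by positivity) ?_ (by norm_num)
  have : 1 ≤ t ^ 2 := one_le_pow₀ ht
  rw [mul_pow]
  nlinarith [sq_nonneg k]

theorem jap_mul_le {k t : ℝ} (ht : 1 ≤ t) : jap (k * t) ≤ t ^ (1 / 2 : ℝ) * jap k := by
  have h0 : 0 ≤ t := by linarith
  have : t ^ (1 / 2 : ℝ) = (t ^ 2) ^ (1 / 4 : ℝ) := by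
    rw [← Real.rpow_natCast, ← Real.rpow_mul h0]; norm_num
  rw [this, jap, jap, ← Real.mul_rpow (by positivity) (by positivity)]
  refine Real.rpow_le_rpow (by positivity) ?_ (by norm_num)
  have : 1 ≤ t ^ 2 := one_le_pow₀ ht
  nlinarith [sq_nonneg k]

/-- One energy controls the solution near the origin and another near infinity; each is monotone in
the direction that bounds it by its value at `1`. -/
theorem exists_bound_of_real_besselPair {μ : ℝ} (hμ : 0 < μ) {h l : ℝ → ℝ}
    (hh : ∀ x, 0 < x → HasDerivAt h (l x / x) x)
    (hl : ∀ x, 0 < x → HasDerivAt l (-(μ ^ 2 + x ^ 2) * h x / x) x) :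
    ∃ c, 0 ≤ c ∧ ∀ x, 0 < x → h x ^ 2 * √(1 + x ^ 2) ≤ c ∧ l x ^ 2 ≤ c * √(1 + x ^ 2) := by
  -- Here `E' = 2x h² ≥ 0`, so `E ≤ E 1` on `(0,1]`. Since `μ > 0`, this bounds `h` as well as `l`
  -- down to the origin.
  set E : ℝ → ℝ := fun x => l x ^ 2 + (x ^ 2 + μ ^ 2) * h x ^ 2 with hE
  have dE : ∀ x, 0 < x → HasDerivAt E (2 * x * h x ^ 2) x := fun x hx => by
    refine (((hl x hx).pow 2).add ((((hasDerivAt_id x).pow 2).add_const (μ ^ 2)).mul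
      ((hh x hx).pow 2))).congr_deriv ?_
    simp
    field_simp
    ring
  have mE : MonotoneOn E (Set.Ioc 0 1) := by
    refine monotoneOn_of_deriv_nonneg (convex_Ioc 0 1)
      (fun x hx => (dE x hx.1).continuousAt.continuousWithinAt)
      (fun x hx => ?_) (fun x hx => ?_) <;> rw [interior_Ioc] at hx
    · exact (dE x hx.1).differentiableAt.differentiableWithinAt
    · rw [(dE x hx.1).deriv]
      have := hx.1
      positivity
  -- The function `u = √x h` satisfies `u'' + (1 + c/x²) u = 0`, and `F` is its energy `u'² + (1 +
  -- c/x²) u²`; it decreases because `c/x²` does.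
  set c := μ ^ 2 + 1 / 4 with hc
  set F : ℝ → ℝ := fun x => (h x / 2 + l x) ^ 2 / x + (x + c / x) * h x ^ 2 with hF
  have dF : ∀ x, 0 < x → HasDerivAt F (-(2 * c / x ^ 2) * h x ^ 2) x := fun x hx => by
    refine ((((((hh x hx).div_const 2).add (hl x hx)).pow 2).div (hasDerivAt_id x) hx.ne').add
      (((hasDerivAt_id x).add ((hasDerivAt_const x c).div (hasDerivAt_id x) hx.ne')).mul
        ((hh x hx).pow 2))).congr_deriv ?_
    simp [hc]
    field_simp
    ring
  have aF : AntitoneOn F (Set.Ici 1) := by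
    refine antitoneOn_of_deriv_nonpos (convex_Ici 1)
      (fun x hx => (dF x (zero_lt_one.trans_le hx)).continuousAt.continuousWithinAt)
      (fun x hx => ?_) (fun x hx => ?_) <;> rw [interior_Ici] at hx
    · exact (dF x (zero_lt_one.trans (Set.mem_Ioi.1 hx))).differentiableAt.differentiableWithinAt
    · have := zero_lt_one.trans (Set.mem_Ioi.1 hx)
      rw [(dF x this).deriv, neg_mul]
      exact neg_nonpos.2 (by positivity)
  have E0 : 0 ≤ E 1 := by positivity
  have F0 : 0 ≤ F 1 := by simp only [hF]; positivity
  -- For `x ≤ 1`, where `√(1+x²) ≤ 2`, the first two summands bound `h` and `l`. For `x ≥ 1`, where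
  -- `x ≤ √(1+x²) ≤ 2x`, the bound on `h` costs `2 F 1` and recovering `l` from `h/2 + l` costs at
  -- most `3 F 1`.
  refine ⟨2 * E 1 / μ ^ 2 + E 1 + 3 * F 1, by positivity, fun x hx => ?_⟩
  have hj : √(1 + x ^ 2) ^ 2 = 1 + x ^ 2 := Real.sq_sqrt (by positivity)
  have hj0 := Real.sqrt_nonneg (1 + x ^ 2)
  set j := √(1 + x ^ 2)
  have hj1 : 1 ≤ j := by nlinarith [sq_nonneg x]
  have h3 : 0 ≤ 2 * E 1 / μ ^ 2 := by positivity
  rcases le_total x 1 with h1 | h1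
  · have hj2 : j ≤ 2 := by nlinarith
    have hb : l x ^ 2 + (x ^ 2 + μ ^ 2) * h x ^ 2 ≤ E 1 := mE ⟨hx, h1⟩ ⟨one_pos, le_rfl⟩ h1
    have hb1 : h x ^ 2 ≤ E 1 / μ ^ 2 := by
      rw [le_div_iff₀ (by positivity)]
      nlinarith [sq_nonneg (l x), mul_nonneg (sq_nonneg x) (sq_nonneg (h x))]
    have hb2 : l x ^ 2 ≤ E 1 := by
      have : 0 ≤ (x ^ 2 + μ ^ 2) * h x ^ 2 := by positivity
      linarith
    constructor
    · have : h x ^ 2 * j ≤ E 1 / μ ^ 2 * 2 := mul_le_mul hb1 hj2 hj0 (by positivity)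
      have e : E 1 / μ ^ 2 * 2 = 2 * E 1 / μ ^ 2 := by ring
      linarith
    · nlinarith
  · have hb : (h x / 2 + l x) ^ 2 / x + (x + c / x) * h x ^ 2 ≤ F 1 :=
      aF Set.self_mem_Ici h1 h1
    have hc0 : 0 ≤ c := by positivity
    have hb1 : x * h x ^ 2 ≤ F 1 := by
      have h4 : 0 ≤ (h x / 2 + l x) ^ 2 / x := by positivity
      have h5 : 0 ≤ c / x * h x ^ 2 := by positivity
      nlinarith
    have hb2 : (h x / 2 + l x) ^ 2 ≤ F 1 * x := by
      rw [← div_le_iff₀ hx]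
      have : 0 ≤ (x + c / x) * h x ^ 2 := by positivity
      linarith
    have hj2 : j ≤ 2 * x := by nlinarith
    have hj3 : x ≤ j := by nlinarith
    constructor
    · nlinarith [mul_le_mul_of_nonneg_left hj2 (sq_nonneg (h x))]
    · have h6 : h x ^ 2 ≤ F 1 * x := by nlinarith [sq_nonneg (h x)]
      have h7 : l x ^ 2 ≤ 3 * (F 1 * x) := by nlinarith [sq_nonneg (h x / 2 + l x + h x / 2)]
      nlinarith [mul_le_mul_of_nonneg_left hj3 F0]

namespace IsBesselPair

variable {μ : ℝ} {H L H' L' : ℝ → ℂ}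

theorem conj (h : IsBesselPair μ H L) :
    IsBesselPair μ (fun x => starRingEnd ℂ (H x)) (fun x => starRingEnd ℂ (L x)) := by
  intro x hx
  refine ⟨(h x hx).1.star.congr_deriv ?_, (h x hx).2.star.congr_deriv ?_⟩ <;> simp

theorem sub (h : IsBesselPair μ H L) (h' : IsBesselPair μ H' L') :
    IsBesselPair μ (fun x => H x - H' x) (fun x => L x - L' x) := by
  intro x hx
  refine ⟨((h x hx).1.sub (h' x hx).1).congr_deriv ?_,
    ((h x hx).2.sub (h' x hx).2).congr_deriv ?_⟩ <;> ring

theorem const_mul (h : IsBesselPair μ H L) (a : ℂ) :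
    IsBesselPair μ (fun x => a * H x) (fun x => a * L x) := by
  intro x hx
  refine ⟨((h x hx).1.const_mul a).congr_deriv ?_,
    ((h x hx).2.const_mul a).congr_deriv ?_⟩ <;> ring

theorem congr_left (h : IsBesselPair μ H L) (h' : ∀ x, 0 < x → H' x = H x) :
    IsBesselPair μ H' L := by
  intro x hx
  refine ⟨(h x hx).1.congr_of_eventuallyEq ?_, h' x hx ▸ (h x hx).2⟩
  filter_upwards [lt_mem_nhds hx] with y hy using h' y hy

/-- Bessel's equation of index `iμ` has real coefficients, so the real and imaginary parts are
estimated separately. -/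
theorem exists_bound (h : IsBesselPair μ H L) (hμ : 0 < μ) :
    ∃ c, 0 < c ∧ ∀ x, 0 < x → ‖H x‖ ≤ c / jap x ∧ ‖L x‖ ≤ c * jap x := by
  have dre : ∀ {f : ℝ → ℂ} {f' : ℂ} {x : ℝ}, HasDerivAt f f' x →
      HasDerivAt (fun y => (f y).re) f'.re x ∧ HasDerivAt (fun y => (f y).im) f'.im x :=
    fun {f f' x} hf => ⟨(Complex.reCLM.hasFDerivAt.comp_hasDerivAt x hf :),
      (Complex.imCLM.hasFDerivAt.comp_hasDerivAt x hf :)⟩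
  have ere : ∀ (z : ℂ) (x : ℝ), (z / x).re = z.re / x ∧ (z / x).im = z.im / x := fun z x =>
    ⟨Complex.div_ofReal_re z x, Complex.div_ofReal_im z x⟩
  have emul : ∀ (z : ℂ) (a : ℝ), (-(a : ℂ) * z).re = -a * z.re ∧ (-(a : ℂ) * z).im = -a * z.im :=
    fun z a => by simp
  obtain ⟨c₁, h₁, b₁⟩ := exists_bound_of_real_besselPair hμ
    (fun x hx => (dre (h x hx).1).1.congr_deriv (ere _ _).1)
    (fun x hx => (dre (h x hx).2).1.congr_deriv (by rw [(ere _ _).1, (emul _ _).1]))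
  obtain ⟨c₂, h₂, b₂⟩ := exists_bound_of_real_besselPair hμ
    (fun x hx => (dre (h x hx).1).2.congr_deriv (ere _ _).2)
    (fun x hx => (dre (h x hx).2).2.congr_deriv (by rw [(ere _ _).2, (emul _ _).2]))
  refine ⟨√(c₁ + c₂) + 1, by positivity, fun x hx => ?_⟩
  have hs : √(c₁ + c₂) ^ 2 = c₁ + c₂ := Real.sq_sqrt (by positivity)
  have hj := jap_pos x
  have hn : ∀ z : ℂ, ‖z‖ ^ 2 = z.re ^ 2 + z.im ^ 2 := fun z => by
    rw [← Complex.normSq_eq_norm_sq, Complex.normSq_apply]; ring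
  have hjs := jap_sq x
  constructor
  · rw [le_div_iff₀ hj]
    refine le_trans (abs_le_of_sq_le_sq' (b := √(c₁ + c₂)) ?_ (by positivity)).2 (by linarith)
    rw [mul_pow, hs, hjs, hn, add_mul]
    exact add_le_add (b₁ x hx).1 (b₂ x hx).1
  · refine le_trans (abs_le_of_sq_le_sq' (b := √(c₁ + c₂) * jap x) ?_ (by positivity)).2
      (by nlinarith)
    rw [mul_pow, hs, hjs, hn, add_mul]
    exact add_le_add (b₁ x hx).2 (b₂ x hx).2

/-- `x W(H, H̄)` is constant. -/
theorem exists_wronskian_eq (h : IsBesselPair μ H L) :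
    ∃ w : ℂ, ∀ x, 0 < x → H x * starRingEnd ℂ (L x) - starRingEnd ℂ (H x) * L x = w := by
  set f : ℝ → ℂ := fun x => H x * starRingEnd ℂ (L x) - starRingEnd ℂ (H x) * L x
  have hf : ∀ x ∈ Set.Ioi (0 : ℝ), HasDerivAt f 0 x := fun x hx => by
    have hx' : (x : ℂ) ≠ 0 := by exact_mod_cast (Set.mem_Ioi.1 hx).ne'
    refine (((h x hx).1.mul (h.conj x hx).2).sub ((h.conj x hx).1.mul (h x hx).2)).congr_deriv ?_
    field_simp
    ring
  refine ⟨f 1, fun x hx => ?_⟩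
  exact isOpen_Ioi.is_const_of_deriv_eq_zero (isPreconnected_Ioi)
    (fun y hy => (hf y hy).differentiableAt.differentiableWithinAt)
    (fun y hy => (hf y hy).deriv) hx (Set.mem_Ioi.2 one_pos)

end IsBesselPair

/-! ### Wronskians of the Bessel and Hankel functions -/

theorem wronskian_besselJ {μ : ℝ} (hμ : 0 < μ) :
    ∃ w : ℂ, w ≠ 0 ∧ ∀ x, 0 < x →
      besselJ (Complex.I * μ) x * starRingEnd ℂ (besselJTheta (Complex.I * μ) x) -
        starRingEnd ℂ (besselJ (Complex.I * μ) x) * besselJTheta (Complex.I * μ) x = w := by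
  obtain ⟨w, hw⟩ := (isBesselPair_besselJ μ).exists_wronskian_eq
  refine ⟨w, ?_, hw⟩
  set ν : ℂ := Complex.I * μ with hν
  have hre : 0 ≤ ν.re := by simp [hν]
  set G : ℝ → ℂ := fun x => besselEntire ν ((x ^ 2 / 4 : ℝ) : ℂ)
  set G' : ℝ → ℂ := fun x => besselEntireDeriv ν ((x ^ 2 / 4 : ℝ) : ℂ)
  have cz : Continuous fun x : ℝ => ((x ^ 2 / 4 : ℝ) : ℂ) := by fun_prop
  have cG : Continuous G := Continuous.comp (g := besselEntire ν) (continuous_iff_continuousAt.2 fun z =>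
    (hasDerivAt_besselEntire hre z).continuousAt) cz
  have cG' : Continuous G' := Continuous.comp (g := besselEntireDeriv ν) (continuous_iff_continuousAt.2 fun z =>
    (exists_hasDerivAt_besselEntireDeriv hre z).choose_spec.1.continuousAt) cz
  -- Since `(x/2)^{iμ}` has modulus one, it drops out of the Wronskian. What remains extends
  -- continuously to `x = 0`, where it equals `-2iμ |G(0)|²` with `G(0) = 1/Γ(1 + iμ) ≠ 0`.
  set f : ℝ → ℂ := fun x => G x * starRingEnd ℂ (ν * G x + ((x ^ 2 / 2 : ℝ) : ℂ) * G' x) -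
    starRingEnd ℂ (G x) * (ν * G x + ((x ^ 2 / 2 : ℝ) : ℂ) * G' x) with hf
  have cf : Continuous f := by
    have := Complex.continuous_conj
    fun_prop
  have e : ∀ x ∈ Set.Ioi (0 : ℝ), f x = w := fun x hx => by
    rw [← hw x hx, besselJ_eq ν hx, besselJTheta]
    have hx2 : (0 : ℝ) < x / 2 := half_pos hx
    have h1 : ((x / 2 : ℝ) : ℂ) ^ ν * starRingEnd ℂ (((x / 2 : ℝ) : ℂ) ^ ν) = 1 := by
      rw [Complex.mul_conj, Complex.normSq_eq_norm_sq, Complex.norm_cpow_eq_rpow_re_of_pos hx2]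
      simp [hν]
    simp only [map_mul, hf]
    linear_combination (-(G x * starRingEnd ℂ (ν * G x + ((x ^ 2 / 2 : ℝ) : ℂ) * G' x)) +
      starRingEnd ℂ (G x) * (ν * G x + ((x ^ 2 / 2 : ℝ) : ℂ) * G' x)) * h1
  have h0 : f 0 = w := by
    have t1 : Filter.Tendsto f (nhdsWithin 0 (Set.Ioi 0)) (nhds (f 0)) :=
      cf.continuousAt.continuousWithinAt
    refine tendsto_nhds_unique t1 ((tendsto_const_nhds (x := w)).congr' ?_)
    filter_upwards [self_mem_nhdsWithin] with x hx using (e x hx).symm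
  have hG0 : G 0 ≠ 0 := by
    have h1 : G 0 = besselCoeff ν 0 := by
      simp only [G, besselEntire]
      rw [tsum_eq_single 0 (fun n hn => by simp [hn])]
      simp
    rw [h1, besselCoeff]
    have : Complex.Gamma ((0 : ℕ) + ν + 1) ≠ 0 :=
      Complex.Gamma_ne_zero_of_re_pos (by simp; linarith)
    simpa using this
  have hf0 : f 0 = -(2 * Complex.I * μ) * (G 0 * starRingEnd ℂ (G 0)) := by
    simp only [hf, hν]
    simp
    ring
  rw [← h0, hf0]
  refine mul_ne_zero ?_ (mul_ne_zero hG0 (by simpa using hG0))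
  simp [hμ.ne']

/-- `x (H_{iμ}⁽¹⁾)'(x)`. -/
def hankelTheta (μ : ℝ) (x : ℝ) : ℂ :=
  (-Real.sinh (μ * Real.pi) : ℂ)⁻¹ * (starRingEnd ℂ (besselJTheta (Complex.I * μ) x) -
    (Real.exp (μ * Real.pi) : ℂ) * besselJTheta (Complex.I * μ) x)

theorem hankel1_eq (μ : ℝ) {x : ℝ} (hx : 0 < x) :
    hankel1 (Complex.I * μ) x = (-Real.sinh (μ * Real.pi) : ℂ)⁻¹ *
      (starRingEnd ℂ (besselJ (Complex.I * μ) x) -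
        (Real.exp (μ * Real.pi) : ℂ) * besselJ (Complex.I * μ) x) := by
  have h1 : -(Complex.I * (μ : ℂ)) = starRingEnd ℂ (Complex.I * μ) := by simp
  have h2 : -(Complex.I * Real.pi * (Complex.I * μ)) = ((μ * Real.pi : ℝ) : ℂ) := by
    push_cast
    linear_combination (-(Real.pi : ℂ) * μ) * Complex.I_sq
  have h3 : Complex.I * Complex.sin (Complex.I * μ * Real.pi) =
      -((Real.sinh (μ * Real.pi) : ℝ) : ℂ) := by
    rw [show Complex.I * μ * Real.pi = ((μ * Real.pi : ℝ) : ℂ) * Complex.I by push_cast; ring,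
      Complex.sin_mul_I, Complex.ofReal_sinh]
    linear_combination Complex.sinh ((μ * Real.pi : ℝ) : ℂ) * Complex.I_sq
  rw [hankel1, h2, h3, h1, besselJ_conj _ hx, ← Complex.ofReal_exp]
  ring

theorem isBesselPair_hankel (μ : ℝ) :
    IsBesselPair μ (hankel1 (Complex.I * μ)) (hankelTheta μ) :=
  (((isBesselPair_besselJ μ).conj.sub ((isBesselPair_besselJ μ).const_mul _)).const_mul
    _).congr_left fun _ hx => hankel1_eq μ hx

/-- With `a = e^{μπ}` and `d = sinh(μπ)`, the Hankel function is `-(J̄ - a J)/d`. The terms `J L`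
and `J̄ L̄` cancel and the Wronskian of `J` is multiplied by `(a² - 1)/d²`, which is nonzero as `μ >
0`. -/
theorem wronskian_hankel {μ : ℝ} (hμ : 0 < μ) :
    ∃ w : ℂ, w ≠ 0 ∧ starRingEnd ℂ w = -w ∧ ∀ x, 0 < x →
      hankel1 (Complex.I * μ) x * starRingEnd ℂ (hankelTheta μ x) -
        starRingEnd ℂ (hankel1 (Complex.I * μ) x) * hankelTheta μ x = w := by
  obtain ⟨w, hw0, hw⟩ := wronskian_besselJ hμ
  have hp : 0 < μ * Real.pi := by positivity
  have hs : Real.sinh (μ * Real.pi) ≠ 0 := (Real.sinh_pos_iff.2 hp).ne'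
  have he : 1 < Real.exp (μ * Real.pi) := Real.one_lt_exp_iff.2 hp
  set a := Real.exp (μ * Real.pi) with ha
  set d := Real.sinh (μ * Real.pi) with hd
  refine ⟨((a ^ 2 - 1 : ℝ) : ℂ) / (d : ℂ) ^ 2 * w, ?_, ?_, fun x hx => ?_⟩
  · refine mul_ne_zero (div_ne_zero ?_ (pow_ne_zero _ (by exact_mod_cast hs))) hw0
    exact_mod_cast (by nlinarith : 0 < a ^ 2 - 1).ne'
  · have : starRingEnd ℂ w = -w := by
      rw [← hw 1 one_pos]; simp
    simp [this]
  · rw [hankel1_eq μ hx, hankelTheta, ← hw x hx, ← ha, ← hd]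
    clear_value a d
    have : (d : ℂ) ≠ 0 := by exact_mod_cast hs
    simp only [map_mul, map_sub, Complex.conj_conj, map_inv₀, map_neg, Complex.conj_ofReal]
    push_cast
    field_simp
    ring

/-! ### The mode functions -/

theorem indexMu_pos {R m : ℝ} (hmR : 3 / 2 < m * R) : 0 < indexMu R m := by
  apply Real.sqrt_pos.2
  nlinarith

theorem hasDerivAt_mode (R m : ℝ) {t k : ℝ} (ht : 0 < t) (hk : 0 < k) :
    HasDerivAt (fun τ => mode R m τ k)
      (((t ^ (1 / 2 : ℝ) : ℝ) : ℂ) * ((Real.exp (-(indexMu R m * Real.pi / 2)) : ℝ) : ℂ) *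
        (3 / 2 * hankel1 (Complex.I * indexMu R m) (k * t) + hankelTheta (indexMu R m) (k * t)))
      t := by
  have hx : 0 < k * t := mul_pos hk ht
  have h1 : HasDerivAt (fun τ : ℝ => ((τ ^ (3 / 2 : ℝ) : ℝ) : ℂ))
      ((3 / 2 * t ^ (3 / 2 - 1 : ℝ) : ℝ) : ℂ) t :=
    (Real.hasDerivAt_rpow_const (.inl ht.ne')).ofReal_comp
  have h2 : HasDerivAt (fun τ : ℝ => hankel1 (Complex.I * indexMu R m) (k * τ))
      (k • (hankelTheta (indexMu R m) (k * t) / ((k * t : ℝ) : ℂ))) t := by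
    have := (isBesselPair_hankel (indexMu R m) (k * t) hx).1
    exact HasDerivAt.scomp (h := fun τ => k * τ) t this
      (by simpa using (hasDerivAt_id t).const_mul k)
  have h3 : t ^ (3 / 2 : ℝ) = t * t ^ (1 / 2 : ℝ) := by
    rw [show (3 / 2 : ℝ) = 1 + 1 / 2 by norm_num, Real.rpow_add ht, Real.rpow_one]
  refine ((h1.mul_const _).mul h2).congr_deriv ?_
  rw [h3, show (3 / 2 - 1 : ℝ) = 1 / 2 by norm_num, Complex.real_smul]
  have hk' : (k : ℂ) ≠ 0 := by exact_mod_cast hk.ne'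
  have ht' : (t : ℂ) ≠ 0 := by exact_mod_cast ht.ne'
  push_cast
  field_simp

theorem modeDeriv_eq (R m : ℝ) {t k : ℝ} (ht : 0 < t) (hk : 0 < k) :
    modeDeriv R m t k =
      ((t ^ (1 / 2 : ℝ) : ℝ) : ℂ) * ((Real.exp (-(indexMu R m * Real.pi / 2)) : ℝ) : ℂ) *
        (3 / 2 * hankel1 (Complex.I * indexMu R m) (k * t) + hankelTheta (indexMu R m) (k * t)) :=
  (hasDerivAt_mode R m ht hk).deriv

/-- Passing from the weight at `kt` to the weight at `k` costs nothing for `v`, whose prefactor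
`t^{3/2}` is at most `t²`. It costs `t^{1/2}` for `t v'`, whose prefactor is also `t^{3/2}`. The
constant leaves room for the sum `3/2 + 1` in the derivative. -/
theorem exists_mode_bound {R m : ℝ} (hmR : 3 / 2 < m * R) :
    ∃ c, 0 < c ∧ ∀ t k : ℝ, 1 ≤ t → 0 < k → ‖mode R m t k‖ ≤ c * t ^ 2 / jap k ∧
      t * ‖modeDeriv R m t k‖ ≤ c * t ^ 2 * jap k := by
  obtain ⟨c, hc, hb⟩ := (isBesselPair_hankel (indexMu R m)).exists_bound (indexMu_pos hmR)
  set e := Real.exp (-(indexMu R m * Real.pi / 2)) with he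
  have he0 : 0 < e := Real.exp_pos _
  refine ⟨3 * c * e, by positivity, fun t k ht hk => ?_⟩
  have ht0 : 0 < t := by linarith
  have hx : 0 < k * t := mul_pos hk ht0
  obtain ⟨b1, b2⟩ := hb _ hx
  have j0 := jap_pos k
  have j1 := jap_le_jap_mul (k := k) ht
  have j2 := jap_mul_le (k := k) ht
  have jx := jap_pos (k * t)
  have hj1 : 1 ≤ jap (k * t) := Real.one_le_rpow (by nlinarith [sq_nonneg (k * t)]) (by norm_num)
  have h12 : t * t ^ (1 / 2 : ℝ) * t ^ (1 / 2 : ℝ) = t ^ 2 := by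
    rw [mul_assoc, ← Real.rpow_add ht0]; norm_num; ring
  have h32 : t ^ (3 / 2 : ℝ) ≤ t ^ 2 := by
    rw [← Real.rpow_natCast]
    exact Real.rpow_le_rpow_of_exponent_le ht (by norm_num)
  have r12 : 0 < t ^ (1 / 2 : ℝ) := Real.rpow_pos_of_pos ht0 _
  have r32 : 0 < t ^ (3 / 2 : ℝ) := Real.rpow_pos_of_pos ht0 _
  constructor
  · rw [mode, norm_mul, norm_mul, Complex.norm_real, Complex.norm_real, Real.norm_of_nonneg r32.le,
      Real.norm_of_nonneg he0.le]
    calc t ^ (3 / 2 : ℝ) * e * ‖hankel1 (Complex.I * indexMu R m) (k * t)‖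
        ≤ t ^ 2 * e * (c / jap k) := by
          gcongr
          exact b1.trans (by gcongr)
      _ ≤ 3 * c * e * t ^ 2 / jap k := by
          rw [← sub_nonneg]
          have : 3 * c * e * t ^ 2 / jap k - t ^ 2 * e * (c / jap k) =
            2 * c * e * t ^ 2 / jap k := by ring
          rw [this]; positivity
  · rw [modeDeriv_eq R m ht0 hk, norm_mul, norm_mul, Complex.norm_real, Complex.norm_real,
      Real.norm_of_nonneg r12.le, Real.norm_of_nonneg he0.le]
    have h5 : ‖3 / 2 * hankel1 (Complex.I * indexMu R m) (k * t) +
        hankelTheta (indexMu R m) (k * t)‖ ≤ 3 * c * (t ^ (1 / 2 : ℝ) * jap k) := by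
      refine (norm_add_le _ _).trans ?_
      rw [norm_mul]
      have h6 : ‖hankel1 (Complex.I * indexMu R m) (k * t)‖ ≤ c * jap (k * t) := by
        refine b1.trans ((div_le_self hc.le hj1).trans ?_)
        nlinarith
      have h7 : ‖(3 / 2 : ℂ)‖ = 3 / 2 := by norm_num
      rw [h7]
      nlinarith [mul_le_mul_of_nonneg_left j2 hc.le]
    calc t * (t ^ (1 / 2 : ℝ) * e * ‖3 / 2 * hankel1 (Complex.I * indexMu R m) (k * t) +
          hankelTheta (indexMu R m) (k * t)‖)
        ≤ t * (t ^ (1 / 2 : ℝ) * e * (3 * c * (t ^ (1 / 2 : ℝ) * jap k))) := by gcongr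
      _ = 3 * c * e * (t * t ^ (1 / 2 : ℝ) * t ^ (1 / 2 : ℝ)) * jap k := by ring
      _ = _ := by rw [h12]

/-- The contributions `(3/2) H` to `v'` cancel in the determinant, and `t² = t^{3/2} t^{1/2}` is the
product of the prefactors of `v` and `v'`. -/
theorem exists_wronskian_eq {R m : ℝ} (hmR : 3 / 2 < m * R) :
    ∃ w : ℂ, w ≠ 0 ∧ starRingEnd ℂ w = -w ∧ ∀ t k : ℝ, 0 < t → 0 < k →
      wronskian R m t k = t ^ 2 * w := by
  obtain ⟨w, hw0, hwc, hw⟩ := wronskian_hankel (indexMu_pos hmR)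
  set e := Real.exp (-(indexMu R m * Real.pi / 2)) with he
  have he0 : (e : ℂ) ≠ 0 := by exact_mod_cast (Real.exp_pos _).ne'
  refine ⟨(e : ℂ) ^ 2 * w, mul_ne_zero (pow_ne_zero _ he0) hw0, by simp [hwc], fun t k ht hk => ?_⟩
  have h3 : t ^ (3 / 2 : ℝ) = t * t ^ (1 / 2 : ℝ) := by
    rw [show (3 / 2 : ℝ) = 1 + 1 / 2 by norm_num, Real.rpow_add ht, Real.rpow_one]
  have h12 : ((t ^ (1 / 2 : ℝ) : ℝ) : ℂ) * ((t ^ (1 / 2 : ℝ) : ℝ) : ℂ) = t := by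
    rw [← Complex.ofReal_mul, ← Real.rpow_add ht]; norm_num
  rw [wronskian, Matrix.det_fin_two_of, modeBar, modeBarDeriv, modeDeriv_eq R m ht hk, mode, h3,
    ← hw _ (mul_pos hk ht)]
  simp only [map_mul, map_add, Complex.conj_ofReal, Complex.ofReal_mul, map_div₀, Complex.conj_ofNat]
  rw [← he]
  generalize ((t ^ (1 / 2 : ℝ) : ℝ) : ℂ) = r at h12
  linear_combination ((e : ℂ) ^ 2 * t * (hankel1 (Complex.I * indexMu R m) (k * t) *
    starRingEnd ℂ (hankelTheta (indexMu R m) (k * t)) -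
    starRingEnd ℂ (hankel1 (Complex.I * indexMu R m) (k * t)) *
      hankelTheta (indexMu R m) (k * t))) * h12

/-! ### Distributions represented by functions -/

namespace RepresentedBy

variable {T T' : 𝓢'(R3, ℂ)} {u u' : R3 → ℂ}

/-- Pairing with a bump function equal to one near `x` turns integrability against test functions
into local integrability. -/
theorem locallyIntegrable (h : RepresentedBy T u) : LocallyIntegrable u := by
  intro x
  let f : ContDiffBump x := ⟨1, 2, one_pos, one_lt_two⟩
  have hg₁ : HasCompactSupport (Complex.ofRealCLM ∘ f) := f.hasCompactSupport.comp_left rfl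
  have hg₂ : ContDiff ℝ ((⊤ : ℕ∞) : WithTop ℕ∞) (Complex.ofRealCLM ∘ f) := Complex.ofRealCLM.contDiff.comp f.contDiff
  refine ⟨Metric.closedBall x 1, Metric.closedBall_mem_nhds x one_pos, ?_⟩
  refine ((h (hg₁.toSchwartzMap hg₂)).1.integrableOn (s := Metric.closedBall x 1)).congr_fun
    (fun y hy => ?_) measurableSet_closedBall
  have : f y = 1 := f.one_of_mem_closedBall hy
  simp [this]

theorem ae_eq (h : RepresentedBy T u) (h' : RepresentedBy T u') : u =ᵐ[volume] u' := by
  refine ae_eq_of_integral_contDiff_smul_eq h.locallyIntegrable h'.locallyIntegrable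
    fun g hg hc => ?_
  have hg₁ : HasCompactSupport (Complex.ofRealCLM ∘ g) := hc.comp_left rfl
  have hg₂ : ContDiff ℝ ((⊤ : ℕ∞) : WithTop ℕ∞) (Complex.ofRealCLM ∘ g) := Complex.ofRealCLM.contDiff.comp hg
  have e := (h (hg₁.toSchwartzMap hg₂)).2.symm.trans (h' (hg₁.toSchwartzMap hg₂)).2
  simpa [mul_comm] using e

theorem congr_ae (h : RepresentedBy T u) (hu : u =ᵐ[volume] u') : RepresentedBy T u' := fun φ => by
  have e : (fun x => u x * φ x) =ᵐ[volume] fun x => u' x * φ x := by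
    filter_upwards [hu] with x hx using by rw [hx]
  exact ⟨(h φ).1.congr e, (h φ).2.trans (integral_congr_ae e)⟩

theorem unique (h : RepresentedBy T u) (h' : RepresentedBy T' u) : T = T' := by
  ext φ
  rw [(h φ).2, (h' φ).2]

theorem smulLeftCLM (h : RepresentedBy T u) {g : R3 → ℂ} (hg : g.HasTemperateGrowth) :
    RepresentedBy (TemperedDistribution.smulLeftCLM ℂ g T) (fun x => g x * u x) := fun φ => by
  have := h (SchwartzMap.smulLeftCLM ℂ g φ)
  rw [TemperedDistribution.smulLeftCLM_apply_apply]
  simp only [SchwartzMap.smulLeftCLM_apply_apply hg, smul_eq_mul] at this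
  have e : ∀ x, g x * u x * φ x = u x * (g x * φ x) := fun x => by ring
  simp only [e]
  exact this

end RepresentedBy

theorem representedBy_lp (f : L2) : RepresentedBy (f : 𝓢'(R3, ℂ)) f := fun φ => by
  constructor
  · have : MemLp φ 2 (volume : Measure R3) := φ.memLp 2
    exact (Lp.memLp f).integrable_mul this
  · simp [mul_comm]

theorem representedBy_zero : RepresentedBy 0 (fun _ => 0) := fun φ => by simp

theorem memLp_comp_smul {r : ℝ} (hr : r ≠ 0) {u : R3 → ℂ} {p : ℝ≥0∞} (hu : MemLp u p) :
    MemLp (fun x => u (r • x)) p := by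
  have h1 : MemLp u p (Measure.map (r • · : R3 → R3) volume) := by
    rw [Measure.map_addHaar_smul volume hr]
    exact hu.smul_measure ENNReal.ofReal_ne_top
  exact (memLp_map_measure_iff h1.1 (measurable_const_smul r).aemeasurable).1 h1

theorem ae_comp_smul {r : ℝ} (hr : r ≠ 0) {p : R3 → Prop} (h : ∀ᵐ x, p x) : ∀ᵐ x : R3, p (r • x) :=
  (Measure.quasiMeasurePreserving_smul (volume : Measure R3) hr).ae h

/-! ### The Fourier transform -/

/-- The factor `(2π)^{3/2}`. -/
def fourierFactor : ℂ := (((2 * Real.pi) ^ (3 / 2 : ℝ) : ℝ) : ℂ)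

theorem fourierFactor_ne_zero : fourierFactor ≠ 0 := by
  unfold fourierFactor
  exact_mod_cast (Real.rpow_pos_of_pos Real.two_pi_pos _).ne'

theorem HasFourierTransform.ae_eq {T : 𝓢'(R3, ℂ)} {g g' : R3 → ℂ} (h : HasFourierTransform T g)
    (h' : HasFourierTransform T g') : g =ᵐ[volume] g' := by
  have e := ae_comp_smul (inv_ne_zero Real.two_pi_pos.ne') (RepresentedBy.ae_eq h h')
  filter_upwards [e] with x hx
  rw [smul_inv_smul₀ Real.two_pi_pos.ne'] at hx
  exact mul_left_cancel₀ fourierFactor_ne_zero hx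

theorem HasFourierTransform.congr_ae {T : 𝓢'(R3, ℂ)} {g g' : R3 → ℂ}
    (h : HasFourierTransform T g) (hg : g =ᵐ[volume] g') : HasFourierTransform T g' := by
  refine RepresentedBy.congr_ae h ?_
  filter_upwards [ae_comp_smul Real.two_pi_pos.ne' hg] with x hx
  rw [hx]

theorem fourier_injective {T T' : 𝓢'(R3, ℂ)} (h : 𝓕 T = 𝓕 T') : T = T' :=
  (fourierEquiv ℂ 𝓢'(R3, ℂ)).injective h

theorem HasFourierTransform.unique {T T' : 𝓢'(R3, ℂ)} {g : R3 → ℂ}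
    (h : HasFourierTransform T g) (h' : HasFourierTransform T' g) : T = T' :=
  fourier_injective (RepresentedBy.unique h h')

/-! ### Sobolev spaces -/

/-- The Bessel weight `(1 + |k|²)^{s/2}`. -/
def besselWeight (s : ℝ) (k : R3) : ℂ := (((1 + ‖k‖ ^ 2) ^ (s / 2) : ℝ) : ℂ)

theorem hasTemperateGrowth_besselWeight (s : ℝ) : (besselWeight s).HasTemperateGrowth := by
  unfold besselWeight
  fun_prop

theorem besselWeight_neg_mul (s : ℝ) (k : R3) : besselWeight (-s) k * besselWeight s k = 1 := by
  unfold besselWeight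
  rw [← Complex.ofReal_mul, ← Real.rpow_add (by positivity)]
  rw [neg_div, neg_add_cancel, Real.rpow_zero, Complex.ofReal_one]

theorem continuous_besselWeight (s : ℝ) : Continuous (besselWeight s) :=
  (hasTemperateGrowth_besselWeight s).1.continuous

theorem norm_besselWeight (s : ℝ) (k : R3) : ‖besselWeight s k‖ = (1 + ‖k‖ ^ 2) ^ (s / 2) := by
  rw [besselWeight, Complex.norm_real, Real.norm_of_nonneg (by positivity)]

/-- Needed to change the normalization of the Fourier transform: Sobolev weights are comparable
under dilation. The number `D` dominates the ratio of `1 + |k|²` and `1 + |rk|²` both ways, and the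
sign of `s` decides which way is used. -/
theorem exists_besselWeight_le (s : ℝ) {r : ℝ} (hr : r ≠ 0) :
    ∃ C, ∀ k : R3, ‖besselWeight s k * besselWeight (-s) (r • k)‖ ≤ C := by
  set D : ℝ := 1 + r ^ 2 + (r ^ 2)⁻¹ with hD
  have hr2 : 0 < r ^ 2 := by positivity
  have hi : 0 < (r ^ 2)⁻¹ := by positivity
  have hri : (r ^ 2)⁻¹ * r ^ 2 = 1 := inv_mul_cancel₀ hr2.ne'
  refine ⟨D ^ |s / 2|, fun k => ?_⟩
  have e1 : 1 + ‖k‖ ^ 2 ≤ D * (1 + ‖r • k‖ ^ 2) := by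
    rw [norm_smul, mul_pow, Real.norm_eq_abs, sq_abs]
    have : (r ^ 2)⁻¹ * (r ^ 2 * ‖k‖ ^ 2) = ‖k‖ ^ 2 := by rw [← mul_assoc, hri, one_mul]
    have h2 : 0 ≤ r ^ 2 * ‖k‖ ^ 2 := by positivity
    nlinarith
  have e2 : 1 + ‖r • k‖ ^ 2 ≤ D * (1 + ‖k‖ ^ 2) := by
    rw [norm_smul, mul_pow, Real.norm_eq_abs, sq_abs]
    nlinarith [sq_nonneg ‖k‖]
  rw [norm_mul, norm_besselWeight, norm_besselWeight, neg_div, Real.rpow_neg (by positivity),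
    ← div_eq_mul_inv]
  have hD0 : 0 < D := by positivity
  rw [div_le_iff₀ (by positivity)]
  rcases le_total 0 (s / 2) with h | h
  · rw [abs_of_nonneg h, ← Real.mul_rpow hD0.le (by positivity)]
    exact Real.rpow_le_rpow (by positivity) e1 h
  · have h3 : (D * (1 + ‖k‖ ^ 2)) ^ (s / 2) ≤ (1 + ‖r • k‖ ^ 2) ^ (s / 2) :=
      Real.rpow_le_rpow_of_nonpos (by positivity) e2 h
    rw [Real.mul_rpow hD0.le (by positivity)] at h3
    rw [abs_of_nonpos h, Real.rpow_neg hD0.le]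
    rw [← div_eq_inv_mul, le_div_iff₀ (by positivity)]
    linarith

theorem memLp_besselWeight_comp_smul {s r : ℝ} (hr : r ≠ 0) {u : R3 → ℂ}
    (hu : MemLp (fun k => besselWeight s k * u k) 2) :
    MemLp (fun k => besselWeight s k * u (r • k)) 2 := by
  obtain ⟨C, hC⟩ := exists_besselWeight_le s hr
  have h1 : MemLp (fun k : R3 => besselWeight s k * besselWeight (-s) (r • k)) ∞ := by
    refine memLp_top_of_bound (Continuous.aestronglyMeasurable ?_) C (.of_forall hC)
    exact (continuous_besselWeight s).mul ((continuous_besselWeight _).comp (continuous_const_smul r))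
  refine ((memLp_comp_smul hr hu).mul (r := 2) h1).ae_eq (.of_forall fun k => ?_)
  have := besselWeight_neg_mul s (r • k)
  simp only [Pi.mul_apply]
  linear_combination besselWeight s k * u (r • k) * this

theorem exists_hasFourierTransform_of_memSobolev {s : ℝ} {T : 𝓢'(R3, ℂ)}
    (h : MemSobolev s 2 T) :
    ∃ g, HasFourierTransform T g ∧ MemLp (fun k => besselWeight s k * g k) 2 := by
  obtain ⟨w, hw⟩ := memSobolev_iff_exists_smulLeftCLM_fourier.1 h
  have hrep : RepresentedBy (𝓕 T) (fun k => besselWeight (-s) k * w k) := by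
    have h1 : TemperedDistribution.smulLeftCLM ℂ (besselWeight (-s)) (w : 𝓢'(R3, ℂ)) = 𝓕 T := by
      rw [← hw]
      change TemperedDistribution.smulLeftCLM ℂ (besselWeight (-s))
        (TemperedDistribution.smulLeftCLM ℂ (besselWeight s) (𝓕 T)) = _
      rw [smulLeftCLM_smulLeftCLM_apply (hasTemperateGrowth_besselWeight _)
        (hasTemperateGrowth_besselWeight _)]
      have : besselWeight s * besselWeight (-s) = fun _ => 1 := by
        ext k
        rw [Pi.mul_apply, mul_comm, besselWeight_neg_mul]
      rw [this, smulLeftCLM_const, one_smul]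
    rw [← h1]
    exact (representedBy_lp w).smulLeftCLM (hasTemperateGrowth_besselWeight _)
  set G : R3 → ℂ := fun k => besselWeight (-s) k * w k with hG
  have hGm : MemLp (fun k => besselWeight s k * G k) 2 := by
    refine (Lp.memLp w).ae_eq (.of_forall fun k => ?_)
    have := besselWeight_neg_mul s k
    simp only [hG]
    linear_combination (-w k) * this
  refine ⟨fun k => fourierFactor⁻¹ * G ((2 * Real.pi)⁻¹ • k), ?_, ?_⟩
  · refine hrep.congr_ae (.of_forall fun k => ?_)
    simp only []
    rw [inv_smul_smul₀ Real.two_pi_pos.ne', ← fourierFactor,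
      mul_inv_cancel_left₀ fourierFactor_ne_zero]
  · refine ((memLp_besselWeight_comp_smul (inv_ne_zero Real.two_pi_pos.ne') hGm).const_mul
      fourierFactor⁻¹).ae_eq (.of_forall fun k => ?_)
    simp only []
    ring

theorem exists_memSobolev_hasFourierTransform {s : ℝ} {g : R3 → ℂ}
    (hg : MemLp (fun k => besselWeight s k * g k) 2) :
    ∃ T : 𝓢'(R3, ℂ), MemSobolev s 2 T ∧ HasFourierTransform T g := by
  have h1 := (memLp_besselWeight_comp_smul Real.two_pi_pos.ne' hg).const_mul fourierFactor
  set w : L2 := h1.toLp _ with hw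
  set S : 𝓢'(R3, ℂ) := TemperedDistribution.smulLeftCLM ℂ (besselWeight (-s)) (w : 𝓢'(R3, ℂ))
    with hS
  have hF : 𝓕 (𝓕⁻ S) = S := fourier_fourierInv_eq S
  refine ⟨𝓕⁻ S, ?_, ?_⟩
  · rw [memSobolev_iff_exists_smulLeftCLM_fourier]
    refine ⟨w, ?_⟩
    change TemperedDistribution.smulLeftCLM ℂ (besselWeight s) _ = _
    rw [hF, hS, smulLeftCLM_smulLeftCLM_apply (hasTemperateGrowth_besselWeight _)
        (hasTemperateGrowth_besselWeight _)]
    have : besselWeight (-s) * besselWeight s = fun _ => 1 := by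
      ext k
      rw [Pi.mul_apply, besselWeight_neg_mul]
    rw [this, smulLeftCLM_const, one_smul]
  · rw [HasFourierTransform, hF]
    refine ((representedBy_lp w).smulLeftCLM (hasTemperateGrowth_besselWeight _)).congr_ae ?_
    filter_upwards [h1.coeFn_toLp] with k hk
    rw [hw, hk]
    have := besselWeight_neg_mul s k
    change _ = fourierFactor * _
    linear_combination fourierFactor * g ((2 * Real.pi) • k) * this

/-! ### Real distributions -/

/-- The complex conjugate of a Schwartz function. -/
def schwartzConj (φ : 𝓢(R3, ℂ)) : 𝓢(R3, ℂ) :=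
  φ.postcompCLM (𝕜 := ℝ) (Complex.conjCLE : ℂ →L[ℝ] ℂ)

theorem schwartzConj_apply (φ : 𝓢(R3, ℂ)) (x : R3) :
    schwartzConj φ x = starRingEnd ℂ (φ x) := rfl

/-- The reflection of a Schwartz function. -/
def schwartzRefl (φ : 𝓢(R3, ℂ)) : 𝓢(R3, ℂ) :=
  SchwartzMap.compCLMOfContinuousLinearEquiv ℝ (ContinuousLinearEquiv.neg ℝ) φ

theorem schwartzRefl_apply (φ : 𝓢(R3, ℂ)) (x : R3) : schwartzRefl φ x = φ (-x) := rfl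

theorem fourier_schwartzConj_schwartzRefl (φ : 𝓢(R3, ℂ)) :
    𝓕 (schwartzConj (schwartzRefl φ)) = schwartzConj (𝓕 φ) := by
  ext x
  rw [schwartzConj_apply, SchwartzMap.fourier_coe, SchwartzMap.fourier_coe, Real.fourier_eq',
    Real.fourier_eq', ← integral_conj, ← integral_neg_eq_self]
  congr 1
  ext y
  rw [schwartzConj_apply, schwartzRefl_apply, neg_neg, smul_eq_mul, smul_eq_mul, map_mul,
    ← Complex.exp_conj, map_mul, Complex.conj_ofReal, Complex.conj_I, inner_neg_left]
  congr 2
  push_cast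
  ring

/-- The test functions `φ + φ̄` and `i(φ - φ̄)` are real, and together they recover the imaginary
and real parts of the identity. -/
theorem isRealDist_iff (T : 𝓢'(R3, ℂ)) :
    IsRealDist T ↔ ∀ φ, T (schwartzConj φ) = starRingEnd ℂ (T φ) := by
  constructor
  · intro h φ
    have h1 : (T (φ + schwartzConj φ)).im = 0 := h _ fun x => by
      simp [schwartzConj_apply]
    have h2 : (T (Complex.I • (φ - schwartzConj φ))).im = 0 := h _ fun x => by
      simp [schwartzConj_apply]
    rw [map_add, Complex.add_im] at h1
    rw [map_smul, map_sub, smul_eq_mul, Complex.mul_im] at h2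
    apply Complex.ext
    · simp at h2 ⊢
      linarith
    · simp at h1 ⊢
      linarith
  · intro h φ hφ
    have : schwartzConj φ = φ := by
      ext x
      rw [schwartzConj_apply]
      exact Complex.conj_eq_iff_im.2 (hφ x)
    have h1 := h φ
    rw [this] at h1
    exact Complex.conj_eq_iff_im.1 h1.symm

theorem RepresentedBy.isRealDist_iff {T : 𝓢'(R3, ℂ)} {u : R3 → ℂ} (h : RepresentedBy T u) :
    IsRealDist T ↔ ∀ᵐ x, starRingEnd ℂ (u x) = u x := by
  have key : ∀ φ : 𝓢(R3, ℂ), Integrable (fun x => starRingEnd ℂ (u x) * φ x) ∧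
      starRingEnd ℂ (T (schwartzConj φ)) = ∫ x, starRingEnd ℂ (u x) * φ x := fun φ => by
    have h1 := h (schwartzConj φ)
    have e : ∀ x, starRingEnd ℂ (u x) * φ x = starRingEnd ℂ (u x * schwartzConj φ x) := fun x => by
      simp [schwartzConj_apply]
    simp only [e]
    refine ⟨(Complex.conjCLE : ℂ →L[ℝ] ℂ).integrable_comp h1.1, ?_⟩
    rw [integral_conj, h1.2]
  rw [DeSitter.isRealDist_iff]
  constructor
  · intro hr
    refine RepresentedBy.ae_eq (T := T) (fun φ => ⟨(key φ).1, ?_⟩) h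
    rw [← (key φ).2, hr, Complex.conj_conj]
  · intro hr φ
    rw [← Complex.conj_conj (T (schwartzConj φ)), (key φ).2, (h φ).2]
    congr 1
    refine integral_congr_ae ?_
    filter_upwards [hr] with x hx using by rw [hx]

theorem fourier_real_iff (T : 𝓢'(R3, ℂ)) : IsRealDist T ↔
    ∀ φ, 𝓕 T (schwartzConj (schwartzRefl φ)) = starRingEnd ℂ (𝓕 T φ) := by
  rw [isRealDist_iff]
  simp only [TemperedDistribution.fourier_apply, fourier_schwartzConj_schwartzRefl]
  constructor
  · exact fun h φ => h _
  · intro h φ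
    have := h (𝓕⁻ φ)
    rwa [fourier_fourierInv_eq] at this

/-- Conjugating and reflecting a test function becomes conjugation after the Fourier transform, so
reality of `T` says that `u` and the conjugate of `u(-·)` represent the same distribution. -/
theorem HasFourierTransform.isRealDist_iff {T : 𝓢'(R3, ℂ)} {g : R3 → ℂ}
    (h : HasFourierTransform T g) :
    IsRealDist T ↔ ∀ᵐ k, starRingEnd ℂ (g (-k)) = g k := by
  set u : R3 → ℂ := fun ξ => fourierFactor * g ((2 * Real.pi) • ξ) with hu
  have hrep : RepresentedBy (𝓕 T) u := h
  have key : ∀ φ : 𝓢(R3, ℂ), Integrable (fun x => starRingEnd ℂ (u (-x)) * φ x) ∧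
      starRingEnd ℂ (𝓕 T (schwartzConj (schwartzRefl φ))) =
        ∫ x, starRingEnd ℂ (u (-x)) * φ x := fun φ => by
    have h1 := hrep (schwartzConj (schwartzRefl φ))
    have e : ∀ x, starRingEnd ℂ (u (-x)) * φ x =
        starRingEnd ℂ (u (-x) * schwartzConj (schwartzRefl φ) (-x)) := fun x => by
      simp [schwartzConj_apply, schwartzRefl_apply]
    simp only [e]
    refine ⟨(Complex.conjCLE : ℂ →L[ℝ] ℂ).integrable_comp h1.1.comp_neg, ?_⟩
    rw [integral_conj, h1.2, integral_neg_eq_self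
      (fun x => u x * schwartzConj (schwartzRefl φ) x) volume]
  rw [fourier_real_iff]
  have e : (∀ᵐ k, starRingEnd ℂ (g (-k)) = g k) ↔ ∀ᵐ k, starRingEnd ℂ (u (-k)) = u k := by
    have hf : starRingEnd ℂ fourierFactor = fourierFactor := Complex.conj_ofReal _
    constructor
    · intro hg
      filter_upwards [ae_comp_smul Real.two_pi_pos.ne' hg] with k hk
      simp only [hu, map_mul, hf, smul_neg, hk]
    · intro hg
      filter_upwards [ae_comp_smul (inv_ne_zero Real.two_pi_pos.ne') hg] with k hk
      simp only [hu, map_mul, hf, smul_neg, smul_inv_smul₀ Real.two_pi_pos.ne'] at hk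
      exact mul_left_cancel₀ fourierFactor_ne_zero hk
  rw [e]
  constructor
  · intro hr
    refine RepresentedBy.ae_eq (T := 𝓕 T) (fun φ => ⟨(key φ).1, ?_⟩) hrep
    rw [← (key φ).2, hr, Complex.conj_conj]
  · intro hr φ
    rw [← Complex.conj_conj (𝓕 T (schwartzConj (schwartzRefl φ))), (key φ).2, (hrep φ).2]
    congr 1
    refine integral_congr_ae ?_
    filter_upwards [hr] with x hx using by rw [hx]

/-! ### Potentials -/

/-- A function with integrable Fourier transform is bounded. -/
theorem FunHasFourierTransform.ae_norm_le {V : R3 → ℝ} {g : R3 → ℂ} (h : FunHasFourierTransform V g)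
    (hg : Integrable g) : ∀ᵐ x, ‖(V x : ℂ)‖ ≤ ‖fourierFactor‖ * ∫ k, ‖g k‖ := by
  obtain ⟨T, hT, hTg⟩ := h
  set u : R3 → ℂ := fun ξ => fourierFactor * g ((2 * Real.pi) • ξ) with hu
  have hrep : RepresentedBy (𝓕 T) u := hTg
  have hui : Integrable u := (hg.comp_smul Real.two_pi_pos.ne').const_mul _
  -- The inverse Fourier transform of the integrable function `u` is continuous and bounded by `∫
  -- ‖u‖`. The multiplication formula shows that it represents `T`, hence equals `V` almost
  -- everywhere.
  set G : R3 → ℂ := 𝓕 (fun x => u (-x)) with hG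
  have hb : ∀ x, ‖G x‖ ≤ ∫ k, ‖u k‖ := fun x => by
    rw [← integral_neg_eq_self (fun k => ‖u k‖)]
    exact VectorFourier.norm_fourierIntegral_le_integral_norm _ _ _ _ _
  have hc : Continuous G :=
    VectorFourier.fourierIntegral_continuous Real.continuous_fourierChar continuous_inner
      hui.comp_neg
  have hT' : RepresentedBy T G := fun φ => by
    refine ⟨(φ.integrable (μ := volume)).bdd_mul hc.aestronglyMeasurable (.of_forall hb), ?_⟩
    have e : T φ = 𝓕 T (𝓕⁻ φ) := by
      rw [TemperedDistribution.fourier_apply, fourier_fourierInv_eq]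
    rw [e, (hrep _).2, ← integral_neg_eq_self]
    have e2 : ∀ x, (𝓕⁻ φ) (-x) = 𝓕 (φ : R3 → ℂ) x := fun x => by
      rw [SchwartzMap.fourierInv_coe, Real.fourierInv_eq_fourier_neg, neg_neg]
    simp only [e2]
    have e3 := (VectorFourier.integral_fourierIntegral_smul_eq_flip (L := innerₗ R3)
      Real.continuous_fourierChar continuous_inner hui.comp_neg (φ.integrable (μ := volume))).symm
    rw [flip_innerₗ] at e3
    exact e3
  have hu1 : ∫ k, ‖u k‖ ≤ ‖fourierFactor‖ * ∫ k, ‖g k‖ := by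
    simp only [hu, norm_mul]
    rw [integral_const_mul, Measure.integral_comp_smul volume (fun k => ‖g k‖)]
    gcongr
    rw [smul_eq_mul]
    -- The Jacobian `(2π)⁻³` of the dilation is at most one and is discarded.
    refine mul_le_of_le_one_left (integral_nonneg fun _ => norm_nonneg _) ?_
    rw [abs_of_nonneg (inv_nonneg.2 (pow_nonneg Real.two_pi_pos.le _))]
    exact inv_le_one_of_one_le₀ (one_le_pow₀ (by linarith [Real.pi_gt_three]))
  filter_upwards [hT.ae_eq hT'] with x hx
  rw [hx]
  exact (hb x).trans hu1

/-! ### Operators on `L²` -/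

open Classical in
/-- Multiplication by the (essentially bounded) function `a` on `L²`. -/
def mulOp (a : R3 → ℂ) : L2 →L[ℂ] L2 :=
  if h : MemLp a ∞ then (ContinuousLinearMap.mul ℂ ℂ).holderL volume ∞ 2 2 (h.toLp a) else 0

theorem mulOp_ae {a : R3 → ℂ} (h : MemLp a ∞) (ψ : L2) :
    mulOp a ψ =ᵐ[volume] fun k => a k * ψ k := by
  rw [mulOp, dif_pos h]
  filter_upwards [ContinuousLinearMap.coeFn_holder (r := 2) (ContinuousLinearMap.mul ℂ ℂ)
    (h.toLp a) ψ, h.coeFn_toLp] with k h1 h2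
  rw [← h2]
  exact h1

/-- Measurability of `a` is not needed: without it the operator is zero by definition. -/
theorem norm_mulOp_le {a : R3 → ℂ} {c : ℝ} (hc : 0 ≤ c) (h : ∀ᵐ k, ‖a k‖ ≤ c) : ‖mulOp a‖ ≤ c := by
  by_cases ha : MemLp a ∞
  · refine ContinuousLinearMap.opNorm_le_bound _ hc fun ψ => ?_
    refine Lp.norm_le_mul_norm_of_ae_le_mul ?_
    filter_upwards [mulOp_ae ha ψ, h] with k h1 h2
    rw [h1, norm_mul]
    gcongr
  · rw [mulOp, dif_neg ha, norm_zero]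
    exact hc

theorem memLp_top_of_ae_norm_le {a : R3 → ℂ} (ha : AEStronglyMeasurable a) {c : ℝ}
    (h : ∀ᵐ k, ‖a k‖ ≤ c) : MemLp a ∞ := memLp_top_of_bound ha c h

theorem inner_mulOp {a : R3 → ℂ} (h : MemLp a ∞) (f g : L2) :
    inner ℂ g (mulOp a f) = inner ℂ (mulOp (fun k => starRingEnd ℂ (a k)) g) f := by
  rw [L2.inner_def, L2.inner_def]
  refine integral_congr_ae ?_
  have h' : MemLp (fun k => starRingEnd ℂ (a k)) ∞ := h.star
  filter_upwards [mulOp_ae h f, mulOp_ae h' g] with k h1 h2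
  rw [h1, h2]
  simp
  ring

theorem measurePreserving_neg_R3 : MeasurePreserving (fun k : R3 => -k) volume volume :=
  Measure.measurePreserving_neg _

/-- The antilinear involution `ψ ↦ conj ψ(-k)`. -/
def starRefl : L2 →L[ℝ] L2 :=
  (Complex.conjCLE : ℂ →L[ℝ] ℂ).compLpL 2 volume ∘L
    (Lp.compMeasurePreservingₗᵢ ℝ _ measurePreserving_neg_R3).toContinuousLinearMap

theorem starRefl_ae (ψ : L2) : starRefl ψ =ᵐ[volume] fun k => starRingEnd ℂ (ψ (-k)) := by
  have h1 := ContinuousLinearMap.coeFn_compLpL (p := 2) (μ := (volume : Measure R3))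
    (Complex.conjCLE : ℂ →L[ℝ] ℂ) (Lp.compMeasurePreserving _ measurePreserving_neg_R3 ψ)
  filter_upwards [h1, Lp.coeFn_compMeasurePreserving ψ measurePreserving_neg_R3] with k h2 h3
  refine h2.trans ?_
  rw [h3]
  rfl

theorem norm_starRefl_apply_le (ψ : L2) : ‖starRefl ψ‖ ≤ ‖ψ‖ := by
  have h : ‖Lp.compMeasurePreserving _ measurePreserving_neg_R3 ψ‖ = ‖ψ‖ :=
    Lp.norm_compMeasurePreserving ψ measurePreserving_neg_R3
  rw [← h]
  refine Lp.norm_le_norm_of_ae_le ?_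
  filter_upwards [starRefl_ae ψ, Lp.coeFn_compMeasurePreserving ψ measurePreserving_neg_R3]
    with k h2 h3
  rw [h2, h3]
  simp

/-- The dilation `f ↦ f(r ·)`. -/
def dilOp (r : ℝ) (hr : r ≠ 0) : L2 →L[ℂ] L2 :=
  LinearMap.mkContinuous
    { toFun := fun f => (memLp_comp_smul hr (Lp.memLp f)).toLp _
      map_add' := fun f g => by
        ext1
        filter_upwards [(memLp_comp_smul hr (Lp.memLp (f + g))).coeFn_toLp,
          (memLp_comp_smul hr (Lp.memLp f)).coeFn_toLp,
          (memLp_comp_smul hr (Lp.memLp g)).coeFn_toLp,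
          Lp.coeFn_add ((memLp_comp_smul hr (Lp.memLp f)).toLp _)
            ((memLp_comp_smul hr (Lp.memLp g)).toLp _),
          ae_comp_smul hr (Lp.coeFn_add f g)] with k h1 h2 h3 h4 h5
        rw [h1, h4, Pi.add_apply, h2, h3, h5, Pi.add_apply]
      map_smul' := fun c f => by
        ext1
        filter_upwards [(memLp_comp_smul hr (Lp.memLp (c • f))).coeFn_toLp,
          (memLp_comp_smul hr (Lp.memLp f)).coeFn_toLp,
          Lp.coeFn_smul c ((memLp_comp_smul hr (Lp.memLp f)).toLp _),
          ae_comp_smul hr (Lp.coeFn_smul c f)] with k h1 h2 h3 h4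
        rw [h1, RingHom.id_apply, h3, Pi.smul_apply, h2, h4, Pi.smul_apply] }
    ((ENNReal.ofReal |(r ^ Module.finrank ℝ R3)⁻¹|) ^ (1 / (2 : ℝ≥0∞)).toReal).toReal
    fun f => by
      have h1 : MemLp f 2 (Measure.map (r • · : R3 → R3) volume) := by
        rw [Measure.map_addHaar_smul volume hr]
        exact (Lp.memLp f).smul_measure ENNReal.ofReal_ne_top
      have h2 := eLpNorm_map_measure (p := 2) h1.1 (measurable_const_smul r).aemeasurable
      rw [Measure.map_addHaar_smul volume hr, eLpNorm_smul_measure_of_ne_top (by simp)] at h2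
      change ‖(memLp_comp_smul hr (Lp.memLp f)).toLp _‖ ≤ _
      rw [Lp.norm_toLp, Lp.norm_def, ← ENNReal.toReal_mul]
      rw [smul_eq_mul] at h2
      rw [h2]
      rfl

theorem dilOp_ae {r : ℝ} (hr : r ≠ 0) (f : L2) : dilOp r hr f =ᵐ[volume] fun k => f (r • k) :=
  (memLp_comp_smul hr (Lp.memLp f)).coeFn_toLp

/-! ### Measurability of families of operators -/

theorem HilbertBasis.countable {ι E : Type*} [NormedAddCommGroup E] [InnerProductSpace ℂ E]
    [SecondCountableTopology E] (b : HilbertBasis ι ℂ E) : Countable ι := by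
  refine Pairwise.countable_of_isOpen_disjoint (s := fun i => Metric.ball (b i) (1 / 2))
    (fun i j hij => ?_) (fun i => Metric.isOpen_ball) (fun i => ⟨b i, by simp⟩)
  refine Metric.ball_disjoint_ball ?_
  -- Distinct basis vectors are at distance `√2 ≥ 1`, so balls of radius `1/2` about them are
  -- disjoint; a second countable space has room for countably many.
  have h1 : ‖b i - b j‖ ^ 2 = 2 := by
    have h2 := b.orthonormal
    rw [@norm_sub_sq ℂ, h2.1 i, h2.1 j, h2.2 hij]
    norm_num
  rw [dist_eq_norm]
  nlinarith [norm_nonneg (b i - b j)]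

/-- A form of Pettis' theorem: the expansion in a countable Hilbert basis writes `F` as a pointwise
limit of finite sums with measurable coefficients. -/
theorem aestronglyMeasurable_of_inner {α E : Type*} [MeasurableSpace α] {ν : Measure α}
    [NormedAddCommGroup E] [InnerProductSpace ℂ E] [CompleteSpace E] [SecondCountableTopology E]
    {F : α → E} (h : ∀ g : E, AEStronglyMeasurable (fun s => inner ℂ g (F s)) ν) :
    AEStronglyMeasurable F ν := by
  obtain ⟨w, b, -⟩ := exists_hilbertBasis ℂ E
  have := HilbertBasis.countable b
  refine aestronglyMeasurable_of_tendsto_ae (Filter.atTop : Filter (Finset w))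
    (f := fun J s => ∑ i ∈ J, b.repr (F s) i • b i) (fun J => ?_)
    (.of_forall fun s => b.hasSum_repr (F s))
  simp only [b.repr_apply_apply]
  exact Finset.aestronglyMeasurable_fun_sum J fun i _ => (h (b i)).smul_const _

instance secondCountableTopology_L2 : SecondCountableTopology L2 :=
  haveI : Fact ((2 : ℝ≥0∞) ≠ ∞) := ⟨by simp⟩
  Lp.SecondCountableTopology

theorem aestronglyMeasurable_mulOp {ν : Measure ℝ} [SFinite ν] {a : ℝ → R3 → ℂ}
    (ha : AEStronglyMeasurable (fun p : ℝ × R3 => a p.1 p.2) (ν.prod volume))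
    (hb : ∀ᵐ s ∂ν, MemLp (a s) ∞) {χ : ℝ → L2} (hχ : AEStronglyMeasurable χ ν) :
    AEStronglyMeasurable (fun s => mulOp (a s) (χ s)) ν := by
  have key : ∀ {a : ℝ → R3 → ℂ},
      AEStronglyMeasurable (fun p : ℝ × R3 => a p.1 p.2) (ν.prod volume) →
      (∀ᵐ s ∂ν, MemLp (a s) ∞) → ∀ f : L2, AEStronglyMeasurable (fun s => mulOp (a s) f) ν := by
    intro a ha hb f
    refine aestronglyMeasurable_of_inner fun g => ?_
    have h1 : AEStronglyMeasurable (fun p : ℝ × R3 => a p.1 p.2 * f p.2 * starRingEnd ℂ (g p.2))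
        (ν.prod volume) :=
      (ha.mul (Lp.aestronglyMeasurable f).comp_snd).mul (Lp.aestronglyMeasurable g).comp_snd.star
    refine h1.integral_prod_right'.congr ?_
    filter_upwards [hb] with s hs
    rw [L2.inner_def]
    refine integral_congr_ae ?_
    filter_upwards [mulOp_ae hs f] with k hk
    rw [hk]
    simp
  -- When the vector also depends on `s`, the multiplier is moved by adjunction onto the fixed
  -- vector `g`, where `key` applies; the inner product of two measurable families is measurable.
  refine aestronglyMeasurable_of_inner fun g => ?_
  have h2 : AEStronglyMeasurable (fun s => mulOp (fun k => starRingEnd ℂ (a s k)) g) ν :=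
    key (a := fun s k => starRingEnd ℂ (a s k)) ha.star (hb.mono fun s hs => hs.star) g
  refine (h2.inner (𝕜 := ℂ) hχ).congr ?_
  filter_upwards [hb] with s hs
  exact (inner_mulOp hs _ _).symm

/-! ### Measurability and size of the mode functions -/

/-- Joint measurability in `(t,k)` comes from continuity of `H` and `L` on the half line. Extending
them by zero avoids any statement about nonpositive arguments. -/
theorem exists_measurable_mode (R m : ℝ) : ∃ F F' : ℝ × ℝ → ℂ, Measurable F ∧ Measurable F' ∧
    ∀ t k, 0 < t → 0 < k → mode R m t k = F (t, k) ∧ modeDeriv R m t k = F' (t, k) := by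
  have hp := isBesselPair_hankel (indexMu R m)
  have aux : ∀ f : ℝ → ℂ, (∀ x, 0 < x → ContinuousAt f x) →
      Measurable ((Set.Ioi (0 : ℝ)).indicator f) := fun f hf => by
    have := ContinuousOn.measurable_piecewise (s := Set.Ioi (0 : ℝ)) (f := f) (g := fun _ => 0)
      (fun x hx => (hf x hx).continuousWithinAt) continuousOn_const measurableSet_Ioi
    have e : (Set.Ioi (0 : ℝ)).indicator f = (Set.Ioi (0 : ℝ)).piecewise f (fun _ => 0) :=
      Set.piecewise_eq_indicator.symm
    rw [e]
    exact this
  have mH := aux _ fun x hx => (hp x hx).1.continuousAt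
  have mL := aux _ fun x hx => (hp x hx).2.continuousAt
  set h := (Set.Ioi (0 : ℝ)).indicator (hankel1 (Complex.I * indexMu R m)) with hh
  set l := (Set.Ioi (0 : ℝ)).indicator (hankelTheta (indexMu R m)) with hl
  have mx : Measurable fun p : ℝ × ℝ => p.2 * p.1 := by fun_prop
  have mr : ∀ r : ℝ, Measurable fun p : ℝ × ℝ => ((p.1 ^ r : ℝ) : ℂ) := fun r => by fun_prop
  have mh := mH.comp mx
  have ml := mL.comp mx
  refine ⟨fun p => ((p.1 ^ (3 / 2 : ℝ) : ℝ) : ℂ) *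
      ((Real.exp (-(indexMu R m * Real.pi / 2)) : ℝ) : ℂ) * h (p.2 * p.1),
    fun p => ((p.1 ^ (1 / 2 : ℝ) : ℝ) : ℂ) *
      ((Real.exp (-(indexMu R m * Real.pi / 2)) : ℝ) : ℂ) *
        (3 / 2 * h (p.2 * p.1) + l (p.2 * p.1)),
    ((mr _).mul_const _).mul mh, ((mr _).mul_const _).mul ((mh.const_mul _).add ml),
    fun t k ht hk => ?_⟩
  have hx : k * t ∈ Set.Ioi (0 : ℝ) := mul_pos hk ht
  rw [modeDeriv_eq R m ht hk, mode]
  simp only [hh, hl, Set.indicator_of_mem hx]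
  exact ⟨trivial, trivial⟩

theorem ae_norm_pos : ∀ᵐ k : R3, 0 < ‖k‖ := by
  filter_upwards [Measure.ae_ne volume (0 : R3)] with k hk using norm_pos_iff.2 hk

theorem aestronglyMeasurable_mode_prod (R m : ℝ) {ν : Measure ℝ} [SFinite ν] {ρ : ℝ → ℝ}
    (hρ : Measurable ρ) (hν : ∀ᵐ s ∂ν, 0 < ρ s) :
    AEStronglyMeasurable (fun p : ℝ × R3 => mode R m (ρ p.1) ‖p.2‖) (ν.prod volume) ∧
    AEStronglyMeasurable (fun p : ℝ × R3 => modeDeriv R m (ρ p.1) ‖p.2‖) (ν.prod volume) := by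
  obtain ⟨F, F', hF, hF', h⟩ := exists_measurable_mode R m
  have mx : Measurable fun p : ℝ × R3 => (ρ p.1, ‖p.2‖) := by fun_prop
  have h1 : ∀ᵐ p : ℝ × R3 ∂(ν.prod volume), 0 < ρ p.1 :=
    Measure.quasiMeasurePreserving_fst.ae hν
  have h2 : ∀ᵐ p : ℝ × R3 ∂(ν.prod volume), 0 < ‖p.2‖ :=
    Measure.quasiMeasurePreserving_snd.ae ae_norm_pos
  constructor
  · refine (hF.comp mx).aestronglyMeasurable.congr ?_
    filter_upwards [h1, h2] with p hp1 hp2 using (h _ _ hp1 hp2).1.symm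
  · refine (hF'.comp mx).aestronglyMeasurable.congr ?_
    filter_upwards [h1, h2] with p hp1 hp2 using (h _ _ hp1 hp2).2.symm

theorem aestronglyMeasurable_mode (R m : ℝ) {s : ℝ} (hs : 0 < s) :
    AEStronglyMeasurable (fun k : R3 => mode R m s ‖k‖) ∧
    AEStronglyMeasurable (fun k : R3 => modeDeriv R m s ‖k‖) := by
  obtain ⟨F, F', hF, hF', h⟩ := exists_measurable_mode R m
  have mx : Measurable fun k : R3 => (s, ‖k‖) := by fun_prop
  constructor
  · refine (hF.comp mx).aestronglyMeasurable.congr ?_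
    filter_upwards [ae_norm_pos] with p hp using (h _ _ hs hp).1.symm
  · refine (hF'.comp mx).aestronglyMeasurable.congr ?_
    filter_upwards [ae_norm_pos] with p hp using (h _ _ hs hp).2.symm

theorem wronskian_eq {R m : ℝ} (hmR : 3 / 2 < m * R) {t k : ℝ} (ht : 0 < t) (hk : 0 < k) :
    wronskian R m t k = t ^ 2 * wronskian R m 1 1 := by
  obtain ⟨w, -, -, hw⟩ := exists_wronskian_eq hmR
  rw [hw t k ht hk, hw 1 1 one_pos one_pos]
  simp

theorem wronskian_one_ne_zero {R m : ℝ} (hmR : 3 / 2 < m * R) : wronskian R m 1 1 ≠ 0 := by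
  obtain ⟨w, hw0, -, hw⟩ := exists_wronskian_eq hmR
  rw [hw 1 1 one_pos one_pos]
  simpa using hw0

theorem wronskian_ne_zero {R m : ℝ} (hmR : 3 / 2 < m * R) {t k : ℝ} (ht : 0 < t) (hk : 0 < k) :
    wronskian R m t k ≠ 0 := by
  rw [wronskian_eq hmR ht hk]
  exact mul_ne_zero (pow_ne_zero _ (by exact_mod_cast ht.ne')) (wronskian_one_ne_zero hmR)

theorem wronskian_eq_det (R m t k : ℝ) : wronskian R m t k =
    mode R m t k * modeBarDeriv R m t k - modeBar R m t k * modeDeriv R m t k :=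
  Matrix.det_fin_two_of _ _ _ _

theorem wronskian_conj (R m t k : ℝ) :
    starRingEnd ℂ (wronskian R m t k) = -wronskian R m t k := by
  rw [wronskian_eq_det, modeBar, modeBarDeriv]
  simp

theorem besselWeight_half (k : R3) : besselWeight (1 / 2) k = (jap ‖k‖ : ℂ) := by
  rw [besselWeight, jap]; norm_num

theorem besselWeight_neg_half (k : R3) : besselWeight (-1 / 2) k = ((jap ‖k‖)⁻¹ : ℂ) := by
  rw [besselWeight, jap, ← Complex.ofReal_inv, ← Real.rpow_neg (by positivity)]; norm_num

theorem memLp_jap_mul_mode {R m : ℝ} (hmR : 3 / 2 < m * R) {s : ℝ} (hs : 1 ≤ s) :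
    MemLp (fun k : R3 => (jap ‖k‖ : ℂ) * mode R m s ‖k‖) ∞ := by
  obtain ⟨c, hc, h⟩ := exists_mode_bound hmR
  have cj : Continuous fun k : R3 => (jap ‖k‖ : ℂ) :=
    Complex.continuous_ofReal.comp (continuous_jap.comp continuous_norm)
  refine memLp_top_of_ae_norm_le (c := c * s ^ 2)
    (cj.aestronglyMeasurable.mul (aestronglyMeasurable_mode R m (by linarith)).1) ?_
  filter_upwards [ae_norm_pos] with k hk
  have hj := jap_pos ‖k‖
  have := (h s _ hs hk).1
  rw [le_div_iff₀ hj] at this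
  rw [norm_mul, Complex.norm_real, Real.norm_of_nonneg hj.le]
  linarith

theorem memLp_jap_inv_mul_modeDeriv {R m : ℝ} (hmR : 3 / 2 < m * R) {s : ℝ} (hs : 1 ≤ s) :
    MemLp (fun k : R3 => ((jap ‖k‖)⁻¹ : ℂ) * (s * modeDeriv R m s ‖k‖)) ∞ := by
  obtain ⟨c, hc, h⟩ := exists_mode_bound hmR
  have cj : Continuous fun k : R3 => ((jap ‖k‖)⁻¹ : ℂ) :=
    (Complex.continuous_ofReal.comp (continuous_jap.comp continuous_norm)).inv₀ fun k => by
      exact Complex.ofReal_ne_zero.2 (jap_pos _).ne'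
  refine memLp_top_of_ae_norm_le (c := c * s ^ 2) (cj.aestronglyMeasurable.mul
    ((aestronglyMeasurable_mode R m (by linarith)).2.const_mul _)) ?_
  filter_upwards [ae_norm_pos] with k hk
  have hj := jap_pos ‖k‖
  have := (h s _ hs hk).2
  rw [norm_mul, norm_inv, Complex.norm_real, Real.norm_of_nonneg hj.le, norm_mul,
    Complex.norm_real, Real.norm_of_nonneg (by linarith), inv_mul_le_iff₀ hj]
  linarith

/-! ### The bijection between Cauchy data and coefficients -/

/-- The Fourier transform of the field at time `s` with coefficient `ψ`. -/
def fieldOf (R m s : ℝ) (ψ : R3 → ℂ) (k : R3) : ℂ :=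
  mode R m s ‖k‖ * ψ k + modeBar R m s ‖k‖ * starRingEnd ℂ (ψ (-k))

/-- The Fourier transform of the momentum at time `s` with coefficient `ψ`. -/
def momentumOf (R m s : ℝ) (ψ : R3 → ℂ) (k : R3) : ℂ :=
  (R : ℂ)⁻¹ * (s * modeDeriv R m s ‖k‖ * ψ k +
    s * modeBarDeriv R m s ‖k‖ * starRingEnd ℂ (ψ (-k)))

/-- The coefficient at time `s` of the data with Fourier transforms `a` and `b`. -/
def coefficientOf (R m s : ℝ) (a b : R3 → ℂ) (k : R3) : ℂ :=
  1 / ((s : ℂ) * wronskian R m s ‖k‖) *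
    (a k * (s * modeBarDeriv R m s ‖k‖) - modeBar R m s ‖k‖ * (R * b k))

theorem isCoefficient_iff_exists (R m s : ℝ) (D : CauchyData) (ψ : L2) :
    IsCoefficient R m s D ψ ↔ ∃ a b : R3 → ℂ, HasFourierTransform D.1.1 a ∧
      HasFourierTransform D.1.2 b ∧ ∀ᵐ k : R3, ψ k = coefficientOf R m s a b k := by
  simp only [IsCoefficient, coefficientOf, Matrix.det_fin_two_of]

theorem conj_fieldOf_neg (R m s : ℝ) (ψ : R3 → ℂ) (k : R3) :
    starRingEnd ℂ (fieldOf R m s ψ (-k)) = fieldOf R m s ψ k := by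
  simp [fieldOf, modeBar, add_comm]

theorem conj_momentumOf_neg (R m s : ℝ) (ψ : R3 → ℂ) (k : R3) :
    starRingEnd ℂ (momentumOf R m s ψ (-k)) = momentumOf R m s ψ k := by
  simp [momentumOf, modeBarDeriv, add_comm]

section Coefficients

variable {R m s : ℝ}

theorem coefficientOf_fieldOf (hR : 0 < R) (hmR : 3 / 2 < m * R) (hs : 0 < s) (ψ : R3 → ℂ)
    {k : R3} (hk : 0 < ‖k‖) :
    coefficientOf R m s (fieldOf R m s ψ) (momentumOf R m s ψ) k = ψ k := by
  have hW := wronskian_ne_zero hmR hs hk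
  have hs' : (s : ℂ) ≠ 0 := by exact_mod_cast hs.ne'
  have hR' : (R : ℂ) ≠ 0 := by exact_mod_cast hR.ne'
  have hd := wronskian_eq_det R m s ‖k‖
  rw [coefficientOf, fieldOf, momentumOf]
  field_simp
  rw [hd]
  ring

/-- By reality of `a` and `b`, and since `W` is imaginary, the conjugate of the coefficient at `-k`
is the second unknown in Cramer's rule. -/
theorem fieldOf_coefficientOf (hmR : 3 / 2 < m * R) (hs : 0 < s)
    {a b ψ : R3 → ℂ} {k : R3} (hk : 0 < ‖k‖) (ha : starRingEnd ℂ (a (-k)) = a k)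
    (hb : starRingEnd ℂ (b (-k)) = b k) (h1 : ψ k = coefficientOf R m s a b k)
    (h2 : ψ (-k) = coefficientOf R m s a b (-k)) : fieldOf R m s ψ k = a k := by
  have hW := wronskian_ne_zero hmR hs hk
  have hs' : (s : ℂ) ≠ 0 := by exact_mod_cast hs.ne'
  have hd := wronskian_eq_det R m s ‖k‖
  rw [fieldOf, h1, h2, coefficientOf, coefficientOf, norm_neg]
  simp only [map_mul, map_sub, map_div₀, map_one, Complex.conj_ofReal, wronskian_conj, ha, hb,
    modeBar, modeBarDeriv, Complex.conj_conj]
  rw [modeBar, modeBarDeriv] at hd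
  field_simp
  rw [hd]
  ring

theorem momentumOf_coefficientOf (hR : 0 < R) (hmR : 3 / 2 < m * R) (hs : 0 < s)
    {a b ψ : R3 → ℂ} {k : R3} (hk : 0 < ‖k‖) (ha : starRingEnd ℂ (a (-k)) = a k)
    (hb : starRingEnd ℂ (b (-k)) = b k) (h1 : ψ k = coefficientOf R m s a b k)
    (h2 : ψ (-k) = coefficientOf R m s a b (-k)) : momentumOf R m s ψ k = b k := by
  have hW := wronskian_ne_zero hmR hs hk
  have hs' : (s : ℂ) ≠ 0 := by exact_mod_cast hs.ne'
  have hR' : (R : ℂ) ≠ 0 := by exact_mod_cast hR.ne'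
  have hd := wronskian_eq_det R m s ‖k‖
  rw [momentumOf, h1, h2, coefficientOf, coefficientOf, norm_neg]
  simp only [map_mul, map_sub, map_div₀, map_one, Complex.conj_ofReal, wronskian_conj, ha, hb,
    modeBar, modeBarDeriv, Complex.conj_conj]
  rw [modeBar, modeBarDeriv] at hd
  field_simp
  rw [hd]
  ring

theorem ae_neg {p : R3 → Prop} (h : ∀ᵐ k, p k) : ∀ᵐ k : R3, p (-k) :=
  measurePreserving_neg_R3.quasiMeasurePreserving.ae h

/-- Solves the defining relation for the data: `ψ` determines both Fourier transforms. This gives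
injectivity of `K_s` and the formula for its inverse. -/
theorem isCoefficient_iff (hR : 0 < R) (hmR : 3 / 2 < m * R) (hs : 0 < s) (D : CauchyData)
    (ψ : L2) : IsCoefficient R m s D ψ ↔
      HasFourierTransform D.1.1 (fieldOf R m s ψ) ∧
      HasFourierTransform D.1.2 (momentumOf R m s ψ) := by
  rw [isCoefficient_iff_exists]
  constructor
  · rintro ⟨a, b, ha, hb, hψ⟩
    have ha' := ha.isRealDist_iff.1 D.2.2.2.1
    have hb' := hb.isRealDist_iff.1 D.2.2.2.2
    constructor
    · refine ha.congr_ae ?_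
      filter_upwards [ae_norm_pos, ha', hb', hψ, ae_neg hψ] with k h0 h1 h2 h3 h4
      exact (fieldOf_coefficientOf hmR hs h0 h1 h2 h3 h4).symm
    · refine hb.congr_ae ?_
      filter_upwards [ae_norm_pos, ha', hb', hψ, ae_neg hψ] with k h0 h1 h2 h3 h4
      exact (momentumOf_coefficientOf hR hmR hs h0 h1 h2 h3 h4).symm
  · rintro ⟨ha, hb⟩
    refine ⟨_, _, ha, hb, ?_⟩
    filter_upwards [ae_norm_pos] with k hk
    exact (coefficientOf_fieldOf hR hmR hs ψ hk).symm

theorem IsCoefficient.ae_eq {D : CauchyData} {ψ : L2} (h : IsCoefficient R m s D ψ) {a b : R3 → ℂ}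
    (ha : HasFourierTransform D.1.1 a) (hb : HasFourierTransform D.1.2 b) :
    ψ =ᵐ[volume] coefficientOf R m s a b := by
  obtain ⟨a', b', ha', hb', h⟩ := (isCoefficient_iff_exists R m s D ψ).1 h
  filter_upwards [h, ha.ae_eq ha', hb.ae_eq hb'] with k h1 h2 h3
  rw [h1, coefficientOf, coefficientOf, h2, h3]

theorem IsCoefficient.unique {D : CauchyData} {ψ ψ' : L2} (h : IsCoefficient R m s D ψ)
    (h' : IsCoefficient R m s D ψ') : ψ = ψ' := by
  obtain ⟨a, b, ha, hb, e⟩ := (isCoefficient_iff_exists R m s D ψ).1 h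
  ext1
  exact Filter.EventuallyEq.trans e (h'.ae_eq ha hb).symm

/-- The weight that puts `a` (respectively `b`) into `L²` is exactly the one whose inverse is left
over from the bound on `v'` (respectively `v`). -/
theorem exists_isCoefficient (hmR : 3 / 2 < m * R) (hs : 1 ≤ s) (D : CauchyData) :
    ∃ ψ, IsCoefficient R m s D ψ := by
  obtain ⟨a, ha, ha'⟩ := exists_hasFourierTransform_of_memSobolev D.2.1
  obtain ⟨b, hb, hb'⟩ := exists_hasFourierTransform_of_memSobolev D.2.2.1
  have h1 := ha'.mul (r := 2) (memLp_jap_inv_mul_modeDeriv hmR hs).star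
  have h2 := (hb'.mul (r := 2) (memLp_jap_mul_mode hmR hs).star).const_mul (R : ℂ)
  have h3 : MemLp (coefficientOf R m s a b) 2 := by
    refine ((h1.sub h2).const_mul (1 / ((s : ℂ) * (s ^ 2 * wronskian R m 1 1)))).ae_eq ?_
    filter_upwards [ae_norm_pos] with k hk
    have hj : (jap ‖k‖ : ℂ) ≠ 0 := by exact_mod_cast (jap_pos _).ne'
    rw [coefficientOf, wronskian_eq hmR (by linarith) hk]
    simp only [Pi.sub_apply, Pi.mul_apply, Pi.star_apply, besselWeight_half, besselWeight_neg_half,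
      RCLike.star_def, map_mul, map_inv₀, Complex.conj_ofReal, modeBar, modeBarDeriv]
    congr 1
    field_simp
  refine ⟨h3.toLp _, (isCoefficient_iff_exists _ _ _ _ _).2 ⟨a, b, ha, hb, h3.coeFn_toLp⟩⟩

theorem memLp_conj_neg {ψ : R3 → ℂ} (h : MemLp ψ 2) :
    MemLp (fun k => starRingEnd ℂ (ψ (-k))) 2 :=
  (h.comp_measurePreserving measurePreserving_neg_R3).star

theorem exists_cauchyData (hR : 0 < R) (hmR : 3 / 2 < m * R) (hs : 1 ≤ s) (ψ : L2) :
    ∃ D, IsCoefficient R m s D ψ := by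
  have m1 := memLp_jap_mul_mode hmR hs
  have m2 := memLp_jap_inv_mul_modeDeriv hmR hs
  have hψ := Lp.memLp ψ
  have hψ' := memLp_conj_neg hψ
  have h1 : MemLp (fun k => besselWeight (1 / 2) k * fieldOf R m s ψ k) 2 := by
    refine ((hψ.mul (r := 2) m1).add (hψ'.mul (r := 2) m1.star)).ae_eq (.of_forall fun k => ?_)
    simp only [Pi.add_apply, Pi.mul_apply, Pi.star_apply, besselWeight_half, fieldOf, modeBar,
      RCLike.star_def, map_mul, Complex.conj_ofReal]
    ring
  have h2 : MemLp (fun k => besselWeight (-1 / 2) k * momentumOf R m s ψ k) 2 := by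
    refine (((hψ.mul (r := 2) m2).add (hψ'.mul (r := 2) m2.star)).const_mul (R : ℂ)⁻¹).ae_eq
      (.of_forall fun k => ?_)
    simp only [Pi.add_apply, Pi.mul_apply, Pi.star_apply, besselWeight_neg_half, momentumOf,
      modeBarDeriv, RCLike.star_def, map_mul, map_inv₀, Complex.conj_ofReal]
    ring
  obtain ⟨T₁, hT₁, hF₁⟩ := exists_memSobolev_hasFourierTransform h1
  obtain ⟨T₂, hT₂, hF₂⟩ := exists_memSobolev_hasFourierTransform h2
  refine ⟨⟨(T₁, T₂), hT₁, hT₂, ?_, ?_⟩, (isCoefficient_iff hR hmR (by linarith) _ _).2 ⟨hF₁, hF₂⟩⟩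
  · exact hF₁.isRealDist_iff.2 (.of_forall (conj_fieldOf_neg R m s ψ))
  · exact hF₂.isRealDist_iff.2 (.of_forall (conj_momentumOf_neg R m s ψ))

theorem isCoefficient_coefficientMap (hmR : 3 / 2 < m * R) (hs : 1 ≤ s) (D : CauchyData) :
    IsCoefficient R m s D (coefficientMap R m s D) :=
  Classical.epsilon_spec (exists_isCoefficient hmR hs D)

theorem bijective_coefficientMap (hR : 0 < R) (hmR : 3 / 2 < m * R) (hs : 1 ≤ s) :
    Function.Bijective (coefficientMap R m s) := by
  have hs0 : 0 < s := by linarith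
  constructor
  · intro D D' h
    have h1 := (isCoefficient_iff hR hmR hs0 _ _).1 (isCoefficient_coefficientMap hmR hs D)
    have h2 := (isCoefficient_iff hR hmR hs0 _ _).1 (isCoefficient_coefficientMap hmR hs D')
    rw [← h] at h2
    exact Subtype.ext (Prod.ext (h1.1.unique h2.1) (h1.2.unique h2.2))
  · intro ψ
    obtain ⟨D, hD⟩ := exists_cauchyData hR hmR hs ψ
    exact ⟨D, (isCoefficient_coefficientMap hmR hs D).unique hD⟩

theorem isCoefficient_coefficientInv (hR : 0 < R) (hmR : 3 / 2 < m * R) (hs : 1 ≤ s) (ψ : L2) :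
    IsCoefficient R m s (coefficientInv R m s ψ) ψ := by
  have h : coefficientMap R m s (coefficientInv R m s ψ) = ψ :=
    Function.rightInverse_invFun (bijective_coefficientMap hR hmR hs).2 ψ
  have h1 := isCoefficient_coefficientMap hmR hs (coefficientInv R m s ψ)
  rwa [h] at h1

end Coefficients

/-! ### Transition operators -/

/-- The linear part of the multiplier of `K_r K_s⁻¹`. -/
def transLin (R m r s : ℝ) (k : R3) : ℂ :=
  1 / ((r : ℂ) * wronskian R m r ‖k‖) *
    (mode R m s ‖k‖ * (r * modeBarDeriv R m r ‖k‖) - modeBar R m r ‖k‖ * (s * modeDeriv R m s ‖k‖))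

/-- The antilinear part of the multiplier of `K_r K_s⁻¹`. -/
def transAnti (R m r s : ℝ) (k : R3) : ℂ :=
  1 / ((r : ℂ) * wronskian R m r ‖k‖) *
    (modeBar R m s ‖k‖ * (r * modeBarDeriv R m r ‖k‖) -
      modeBar R m r ‖k‖ * (s * modeBarDeriv R m s ‖k‖))

/-- The operator `ψ ↦ a ψ + b ψ*` with `ψ*(k) = conj ψ(-k)`. -/
def pairOp (a b : R3 → ℂ) : L2 →L[ℝ] L2 :=
  (mulOp a).restrictScalars ℝ + (mulOp b).restrictScalars ℝ ∘L starRefl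

theorem pairOp_apply (a b : R3 → ℂ) (ψ : L2) :
    pairOp a b ψ = mulOp a ψ + mulOp b (starRefl ψ) := rfl

theorem pairOp_ae {a b : R3 → ℂ} (ha : MemLp a ∞) (hb : MemLp b ∞) (ψ : L2) :
    pairOp a b ψ =ᵐ[volume] fun k => a k * ψ k + b k * starRingEnd ℂ (ψ (-k)) := by
  rw [pairOp_apply]
  filter_upwards [Lp.coeFn_add (mulOp a ψ) (mulOp b (starRefl ψ)), mulOp_ae ha ψ,
    mulOp_ae hb (starRefl ψ), starRefl_ae ψ] with k h1 h2 h3 h4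
  rw [h1, Pi.add_apply, h2, h3, h4]

theorem norm_pairOp_le {a b : R3 → ℂ} {c : ℝ} (hc : 0 ≤ c) (ha : ∀ᵐ k, ‖a k‖ ≤ c)
    (hb : ∀ᵐ k, ‖b k‖ ≤ c) : ‖pairOp a b‖ ≤ 2 * c := by
  refine ContinuousLinearMap.opNorm_le_bound _ (by positivity) fun ψ => ?_
  rw [pairOp_apply]
  refine (norm_add_le _ _).trans ?_
  have h1 := (mulOp a).le_of_opNorm_le (norm_mulOp_le hc ha) ψ
  have h2 := (mulOp b).le_of_opNorm_le (norm_mulOp_le hc hb) (starRefl ψ)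
  have h3 := mul_le_mul_of_nonneg_left (norm_starRefl_apply_le ψ) hc
  linarith

/-- The operator `K_r K_s⁻¹`. -/
def transOp (R m r s : ℝ) : L2 →L[ℝ] L2 := pairOp (transLin R m r s) (transAnti R m r s)

theorem exists_trans_bound {R m : ℝ} (hmR : 3 / 2 < m * R) :
    ∃ c, 0 < c ∧ ∀ r s : ℝ, 1 ≤ r → 1 ≤ s → ∀ k : R3, 0 < ‖k‖ →
      ‖transLin R m r s k‖ ≤ c * s ^ 2 ∧ ‖transAnti R m r s k‖ ≤ c * s ^ 2 := by
  obtain ⟨c, hc, hb⟩ := exists_mode_bound hmR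
  have hw := norm_pos_iff.2 (wronskian_one_ne_zero hmR)
  refine ⟨2 * c ^ 2 / ‖wronskian R m 1 1‖, by positivity, fun r s hr hs k hk => ?_⟩
  have hr0 : 0 < r := by linarith
  have hs0 : 0 < s := by linarith
  have hj := jap_pos ‖k‖
  obtain ⟨br, br'⟩ := hb r _ hr hk
  obtain ⟨bs, bs'⟩ := hb s _ hs hk
  -- The linear and antilinear multipliers differ only by conjugations, so both follow from one
  -- estimate on norms. The weights cancel, and `r²` against the `r³` of `r W` leaves `s²/r ≤ s²`.
  have key : ∀ x₁ y₁ x₂ y₂ : ℂ, ‖x₁‖ = ‖mode R m s ‖k‖‖ → ‖y₁‖ = r * ‖modeDeriv R m r ‖k‖‖ →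
      ‖x₂‖ = ‖mode R m r ‖k‖‖ → ‖y₂‖ = s * ‖modeDeriv R m s ‖k‖‖ →
      ‖1 / ((r : ℂ) * wronskian R m r ‖k‖) * (x₁ * y₁ - x₂ * y₂)‖ ≤
        2 * c ^ 2 / ‖wronskian R m 1 1‖ * s ^ 2 := by
    intro x₁ y₁ x₂ y₂ h1 h2 h3 h4
    have e1 : ‖x₁ * y₁‖ ≤ c * s ^ 2 / jap ‖k‖ * (c * r ^ 2 * jap ‖k‖) := by
      rw [norm_mul, h1, h2]
      exact mul_le_mul bs br' (by positivity) (by positivity)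
    have e2 : ‖x₂ * y₂‖ ≤ c * r ^ 2 / jap ‖k‖ * (c * s ^ 2 * jap ‖k‖) := by
      rw [norm_mul, h3, h4]
      exact mul_le_mul br bs' (by positivity) (by positivity)
    have e3 : ‖x₁ * y₁ - x₂ * y₂‖ ≤ 2 * c ^ 2 * s ^ 2 * r ^ 2 := by
      refine (norm_sub_le _ _).trans ((add_le_add e1 e2).trans (le_of_eq ?_))
      field_simp
      ring
    rw [norm_mul, norm_div, norm_one, norm_mul, Complex.norm_real, wronskian_eq hmR hr0 hk,
      norm_mul, norm_pow, Complex.norm_real, Real.norm_of_nonneg hr0.le]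
    calc 1 / (r * (r ^ 2 * ‖wronskian R m 1 1‖)) * ‖x₁ * y₁ - x₂ * y₂‖
        ≤ 1 / (r * (r ^ 2 * ‖wronskian R m 1 1‖)) * (2 * c ^ 2 * s ^ 2 * r ^ 2) := by gcongr
      _ = 2 * c ^ 2 / ‖wronskian R m 1 1‖ * s ^ 2 / r := by field_simp
      _ ≤ _ := div_le_self (by positivity) hr
  constructor
  · refine key _ _ _ _ rfl ?_ ?_ ?_ <;> simp [modeBar, modeBarDeriv, abs_of_pos, hr0, hs0]
  · refine key _ _ _ _ ?_ ?_ ?_ ?_ <;> simp [modeBar, modeBarDeriv, abs_of_pos, hr0, hs0]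

theorem aestronglyMeasurable_trans_prod (R m : ℝ) {ν : Measure ℝ} [SFinite ν] {ρ σ : ℝ → ℝ}
    (hρ : Measurable ρ) (hσ : Measurable σ) (hρν : ∀ᵐ s ∂ν, 0 < ρ s) (hσν : ∀ᵐ s ∂ν, 0 < σ s) :
    AEStronglyMeasurable (fun p : ℝ × R3 => transLin R m (ρ p.1) (σ p.1) p.2) (ν.prod volume) ∧
    AEStronglyMeasurable (fun p : ℝ × R3 => transAnti R m (ρ p.1) (σ p.1) p.2)
      (ν.prod volume) := by
  obtain ⟨vr, vr'⟩ := aestronglyMeasurable_mode_prod R m hρ hρν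
  obtain ⟨vs, vs'⟩ := aestronglyMeasurable_mode_prod R m hσ hσν
  have mr : AEStronglyMeasurable (fun p : ℝ × R3 => ((ρ p.1 : ℝ) : ℂ)) (ν.prod volume) :=
    (Complex.measurable_ofReal.comp (hρ.comp measurable_fst)).aestronglyMeasurable
  have ms : AEStronglyMeasurable (fun p : ℝ × R3 => ((σ p.1 : ℝ) : ℂ)) (ν.prod volume) :=
    (Complex.measurable_ofReal.comp (hσ.comp measurable_fst)).aestronglyMeasurable
  have hW := (vr.mul vr'.star).sub (vr.star.mul vr')
  have hi := (mr.mul hW).aemeasurable.inv.aestronglyMeasurable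
  constructor
  · refine (hi.mul ((vs.mul (mr.mul vr'.star)).sub (vr.star.mul (ms.mul vs')))).congr
      (.of_forall fun p => ?_)
    simp [transLin, wronskian_eq_det, modeBar, modeBarDeriv]
  · refine (hi.mul ((vs.star.mul (mr.mul vr'.star)).sub (vr.star.mul (ms.mul vs'.star)))).congr
      (.of_forall fun p => ?_)
    simp [transAnti, wronskian_eq_det, modeBar, modeBarDeriv]

theorem memLp_trans {R m : ℝ} (hmR : 3 / 2 < m * R) {r s : ℝ} (hr : 1 ≤ r) (hs : 1 ≤ s) :
    MemLp (transLin R m r s) ∞ ∧ MemLp (transAnti R m r s) ∞ := by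
  obtain ⟨c, hc, hb⟩ := exists_trans_bound hmR
  obtain ⟨vr, vr'⟩ := aestronglyMeasurable_mode R m (s := r) (by linarith)
  obtain ⟨vs, vs'⟩ := aestronglyMeasurable_mode R m (s := s) (by linarith)
  have hW := (vr.mul vr'.star).sub (vr.star.mul vr')
  have hi := (hW.const_mul (r : ℂ)).aemeasurable.inv.aestronglyMeasurable
  constructor
  · refine memLp_top_of_ae_norm_le ((hi.mul ((vs.mul (vr'.star.const_mul (r : ℂ))).sub
      (vr.star.mul (vs'.const_mul (s : ℂ))))).congr (.of_forall fun p => ?_)) (c := c * s ^ 2) ?_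
    · simp [transLin, wronskian_eq_det, modeBar, modeBarDeriv]
    · filter_upwards [ae_norm_pos] with k hk using (hb r s hr hs k hk).1
  · refine memLp_top_of_ae_norm_le ((hi.mul ((vs.star.mul (vr'.star.const_mul (r : ℂ))).sub
      (vr.star.mul (vs'.star.const_mul (s : ℂ))))).congr (.of_forall fun p => ?_)) (c := c * s ^ 2) ?_
    · simp [transAnti, wronskian_eq_det, modeBar, modeBarDeriv]
    · filter_upwards [ae_norm_pos] with k hk using (hb r s hr hs k hk).2

theorem exists_norm_transOp_le {R m : ℝ} (hmR : 3 / 2 < m * R) :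
    ∃ c, 0 < c ∧ ∀ r s : ℝ, 1 ≤ r → 1 ≤ s → ‖transOp R m r s‖ ≤ c * s ^ 2 := by
  obtain ⟨c, hc, hb⟩ := exists_trans_bound hmR
  refine ⟨2 * c, by positivity, fun r s hr hs => ?_⟩
  rw [mul_assoc]
  refine norm_pairOp_le (by positivity) ?_ ?_
  · filter_upwards [ae_norm_pos] with k hk using (hb r s hr hs k hk).1
  · filter_upwards [ae_norm_pos] with k hk using (hb r s hr hs k hk).2

theorem aestronglyMeasurable_transOp {R m : ℝ} (hmR : 3 / 2 < m * R) {ν : Measure ℝ} [SFinite ν]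
    {ρ σ : ℝ → ℝ} (hρ : Measurable ρ) (hσ : Measurable σ) (hρν : ∀ᵐ s ∂ν, 1 ≤ ρ s)
    (hσν : ∀ᵐ s ∂ν, 1 ≤ σ s) {χ : ℝ → L2} (hχ : AEStronglyMeasurable χ ν) :
    AEStronglyMeasurable (fun s => transOp R m (ρ s) (σ s) (χ s)) ν := by
  obtain ⟨m1, m2⟩ := aestronglyMeasurable_trans_prod R m hρ hσ
    (hρν.mono fun s hs => by linarith) (hσν.mono fun s hs => by linarith)
  have hm : ∀ᵐ s ∂ν, MemLp (transLin R m (ρ s) (σ s)) ∞ ∧ MemLp (transAnti R m (ρ s) (σ s)) ∞ := by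
    filter_upwards [hρν, hσν] with s h1 h2 using memLp_trans hmR h1 h2
  have a1 := aestronglyMeasurable_mulOp (a := fun s => transLin R m (ρ s) (σ s)) m1
    (hm.mono fun s hs => hs.1) hχ
  have a2 := aestronglyMeasurable_mulOp (a := fun s => transAnti R m (ρ s) (σ s)) m2
    (hm.mono fun s hs => hs.2) (starRefl.continuous.comp_aestronglyMeasurable hχ)
  exact a1.add a2

theorem coefficientMap_coefficientInv {R m : ℝ} (hR : 0 < R) (hmR : 3 / 2 < m * R) {r s : ℝ}
    (hr : 1 ≤ r) (hs : 1 ≤ s) (ψ : L2) :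
    coefficientMap R m r (coefficientInv R m s ψ) = transOp R m r s ψ := by
  obtain ⟨ha, hb⟩ := (isCoefficient_iff hR hmR (by linarith) _ _).1
    (isCoefficient_coefficientInv hR hmR hs ψ)
  have h := (isCoefficient_coefficientMap hmR hr (coefficientInv R m s ψ)).ae_eq ha hb
  obtain ⟨m1, m2⟩ := memLp_trans hmR hr hs
  have hR' : (R : ℂ) ≠ 0 := by exact_mod_cast hR.ne'
  ext1
  filter_upwards [h, pairOp_ae m1 m2 ψ] with k h1 h2
  rw [h1, transOp, h2, coefficientOf, fieldOf, momentumOf, transLin, transAnti,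
    mul_inv_cancel_left₀ hR']
  ring

/-- The two times separate: one factor depends on `t` alone and the other on `s` alone. This drives
both the measurability and the bounds of the Dyson terms. -/
theorem freeHat_eq {R m : ℝ} (hR : 0 < R) (hmR : 3 / 2 < m * R) {t s : ℝ} (ht : 1 ≤ t)
    (hs : 1 ≤ s) (ψ : L2) :
    freeHat R m t s ψ = transOp R m 1 t (transOp R m s 1 ψ) := by
  rw [freeHat, freeEvolution, coefficientMap_coefficientInv hR hmR hs le_rfl,
    coefficientMap_coefficientInv hR hmR le_rfl ht]

/-! ### The perturbation -/

theorem FunHasFourierTransform.aestronglyMeasurable {V : R3 → ℝ} {g : R3 → ℂ}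
    (h : FunHasFourierTransform V g) : AEStronglyMeasurable (fun x => (V x : ℂ)) := by
  obtain ⟨T, hT, -⟩ := h
  exact hT.locallyIntegrable.aestronglyMeasurable

/-- Multiplication by `V` in position space, for `D` with `D.1` represented by `u`. -/
theorem exists_isPotentialImage_of_eq {V : R3 → ℝ} (hV : MemLp (fun x => (V x : ℂ)) ∞)
    (D : CauchyData) {u : L2} (hu : D.1.1 = (u : 𝓢'(R3, ℂ))) :
    ∃ D', IsPotentialImage V D D' ∧ D'.1.2 = (mulOp (fun x => (V x : ℂ)) u : L2) := by
  have hrep : RepresentedBy D.1.1 u := hu ▸ representedBy_lp u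
  have hrep' := (representedBy_lp (mulOp (fun x => (V x : ℂ)) u)).congr_ae (mulOp_ae hV u)
  have hreal := hrep.isRealDist_iff.1 D.2.2.2.1
  refine ⟨⟨(0, ((mulOp (fun x => (V x : ℂ)) u : L2) : 𝓢'(R3, ℂ))), memSobolev_fun_zero _ _ _ _,
    ?_, fun _ _ => rfl, ?_⟩, ⟨rfl, u, hrep, hrep'⟩, rfl⟩
  · exact (memSobolev_zero_iff.2 ⟨_, rfl⟩ : MemSobolev 0 2 _).mono (by norm_num)
  · refine hrep'.isRealDist_iff.2 ?_
    filter_upwards [hreal] with x hx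
    rw [map_mul, Complex.conj_ofReal, hx]

/-- The field lies in `H^{1/2} ⊂ L²`, multiplication by a bounded function preserves `L²`, and `L² ⊂
H^{-1/2}`. -/
theorem isPotentialImage_potentialMap {V : R3 → ℝ} (hV : MemLp (fun x => (V x : ℂ)) ∞)
    (D : CauchyData) : IsPotentialImage V D (potentialMap V D) := by
  have h0 : MemSobolev 0 2 D.1.1 := D.2.1.mono (by norm_num)
  obtain ⟨u, hu⟩ := memSobolev_zero_iff.1 h0
  obtain ⟨D', hD', -⟩ := exists_isPotentialImage_of_eq hV D hu
  exact Classical.epsilon_spec ⟨D', hD'⟩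

theorem IsPotentialImage.unique {V : R3 → ℝ} {D D₁ D₂ : CauchyData} (h₁ : IsPotentialImage V D D₁)
    (h₂ : IsPotentialImage V D D₂) : D₁ = D₂ := by
  obtain ⟨z₁, u₁, hu₁, hv₁⟩ := h₁
  obtain ⟨z₂, u₂, hu₂, hv₂⟩ := h₂
  refine Subtype.ext (Prod.ext (z₁.trans z₂.symm) (hv₁.unique (hv₂.congr_ae ?_)))
  filter_upwards [hu₁.ae_eq hu₂] with x hx
  rw [hx]

/-- The multiplier of `K (0, ·)`. -/
def momentumMultiplier (R m : ℝ) (k : R3) : ℂ :=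
  -(R : ℂ) * (wronskian R m 1 1)⁻¹ * modeBar R m 1 ‖k‖

theorem memLp_mode {R m : ℝ} (hmR : 3 / 2 < m * R) :
    MemLp (fun k : R3 => mode R m 1 ‖k‖) ∞ := by
  obtain ⟨c, hc, hb⟩ := exists_mode_bound hmR
  refine memLp_top_of_ae_norm_le (aestronglyMeasurable_mode R m one_pos).1 (c := c) ?_
  filter_upwards [ae_norm_pos] with k hk
  refine (hb 1 _ le_rfl hk).1.trans ?_
  rw [one_pow, mul_one]
  exact div_le_self hc.le (Real.one_le_rpow (by nlinarith [sq_nonneg ‖k‖]) (by norm_num))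

/-- The map from the coefficient at time `1` to the field in position space. -/
def fieldOp (R m : ℝ) : L2 →L[ℝ] L2 :=
  ((Lp.fourierTransformₗᵢ R3 ℂ).symm.toContinuousLinearEquiv.toContinuousLinearMap ∘L
    (fourierFactor • dilOp (2 * Real.pi) Real.two_pi_pos.ne')).restrictScalars ℝ ∘L
    pairOp (fun k => mode R m 1 ‖k‖) (fun k => modeBar R m 1 ‖k‖)

/-- The map from the momentum in position space to the coefficient at time `1`. -/
def momentumOp (R m : ℝ) : L2 →L[ℝ] L2 :=
  (mulOp (momentumMultiplier R m) ∘L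
    (fourierFactor⁻¹ • dilOp (2 * Real.pi)⁻¹ (inv_ne_zero Real.two_pi_pos.ne')) ∘L
    (Lp.fourierTransformₗᵢ R3 ℂ).toContinuousLinearEquiv.toContinuousLinearMap).restrictScalars ℝ

theorem coefficientInv_fst_eq {R m : ℝ} (hR : 0 < R) (hmR : 3 / 2 < m * R) (ψ : L2) :
    (coefficientInv R m 1 ψ).1.1 = (fieldOp R m ψ : L2) := by
  have h := ((isCoefficient_iff hR hmR one_pos _ _).1
    (isCoefficient_coefficientInv hR hmR le_rfl ψ)).1
  set χ := pairOp (fun k => mode R m 1 ‖k‖) (fun k => modeBar R m 1 ‖k‖) ψ with hχ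
  have e : fieldOf R m 1 ψ =ᵐ[volume] χ :=
    (pairOp_ae (memLp_mode hmR) (memLp_mode hmR).star ψ).symm
  have h1 : RepresentedBy (𝓕 (coefficientInv R m 1 ψ).1.1) _ := h.congr_ae e
  set w : L2 := fourierFactor • dilOp (2 * Real.pi) Real.two_pi_pos.ne' χ with hw
  have h2 : RepresentedBy (𝓕 (coefficientInv R m 1 ψ).1.1) w := by
    refine h1.congr_ae ?_
    filter_upwards [Lp.coeFn_smul fourierFactor (dilOp (2 * Real.pi) Real.two_pi_pos.ne' χ),
      dilOp_ae Real.two_pi_pos.ne' χ] with k h3 h4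
    rw [hw, h3, Pi.smul_apply, h4]
    rfl
  have h3 : 𝓕 (coefficientInv R m 1 ψ).1.1 = (w : 𝓢'(R3, ℂ)) := h2.unique (representedBy_lp w)
  refine fourier_injective ?_
  rw [h3, Lp.fourier_toTemperedDistribution_eq]
  congr 1
  exact ((Lp.fourierTransformₗᵢ R3 ℂ).apply_symm_apply w).symm

theorem potentialHat_eq {R m : ℝ} (hR : 0 < R) (hmR : 3 / 2 < m * R) {V : ℝ → R3 → ℝ} {s : ℝ}
    (hV : MemLp (fun x => (V s x : ℂ)) ∞) (ψ : L2) :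
    potentialHat R m V s ψ =
      momentumOp R m (mulOp (fun x => (V s x : ℂ)) (fieldOp R m ψ)) := by
  obtain ⟨D', hD', hD2⟩ := exists_isPotentialImage_of_eq hV _ (coefficientInv_fst_eq hR hmR ψ)
  have hD : potentialMap (V s) (coefficientInv R m 1 ψ) = D' :=
    (isPotentialImage_potentialMap hV _).unique hD'
  rw [potentialHat, hD]
  set u' : L2 := mulOp (fun x => (V s x : ℂ)) (fieldOp R m ψ) with hu'
  set w : L2 := fourierFactor⁻¹ • dilOp (2 * Real.pi)⁻¹ (inv_ne_zero Real.two_pi_pos.ne') (𝓕 u')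
    with hw
  have hb : HasFourierTransform D'.1.2 w := by
    rw [HasFourierTransform, hD2, Lp.fourier_toTemperedDistribution_eq]
    refine (representedBy_lp _).congr_ae ?_
    filter_upwards [ae_comp_smul Real.two_pi_pos.ne' (Lp.coeFn_smul fourierFactor⁻¹
      (dilOp (2 * Real.pi)⁻¹ (inv_ne_zero Real.two_pi_pos.ne') (𝓕 u'))),
      ae_comp_smul Real.two_pi_pos.ne'
        (dilOp_ae (inv_ne_zero Real.two_pi_pos.ne') (𝓕 u'))] with k h1 h2
    rw [hw, h1, Pi.smul_apply, h2, inv_smul_smul₀ Real.two_pi_pos.ne', smul_eq_mul,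
      ← fourierFactor, mul_inv_cancel_left₀ fourierFactor_ne_zero]
  have ha : HasFourierTransform D'.1.1 (fun _ => 0) := by
    have h1 : 𝓕 D'.1.1 = 0 := by
      rw [hD'.1]
      ext φ
      rfl
    rw [HasFourierTransform, h1]
    simpa using representedBy_zero
  have h := (isCoefficient_coefficientMap hmR le_rfl D').ae_eq ha hb
  have hmm : MemLp (momentumMultiplier R m) ∞ := (memLp_mode hmR).star.const_mul _
  change _ = mulOp (momentumMultiplier R m) w
  ext1
  filter_upwards [h, mulOp_ae hmm w, ae_norm_pos] with k h1 h2 hk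
  rw [h1, h2, coefficientOf, momentumMultiplier, wronskian_eq hmR one_pos hk]
  simp
  ring

/-! ### The Dyson series -/

/-- The factorized data behind the Dyson series on the time interval `[1,t]`: the free evolution is
`Û₀(s,r) = Q s ∘ P r` and the perturbation is `B r`. -/
structure DysonData (R m : ℝ) (V : ℝ → R3 → ℝ) (t q p b : ℝ) where
  Q : ℝ → L2 →L[ℝ] L2
  P : ℝ → L2 →L[ℝ] L2
  B : ℝ → L2 →L[ℝ] L2
  freeHat_eq : ∀ s ∈ Set.Icc 1 t, ∀ r ∈ Set.Icc 1 t, ∀ ψ, freeHat R m s r ψ = Q s (P r ψ)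
  potentialHat_eq : ∀ r ∈ Set.Icc 1 t, ∀ ψ, potentialHat R m V r ψ = B r ψ
  norm_Q_le : ∀ s ∈ Set.Icc 1 t, ‖Q s‖ ≤ q
  norm_P_le : ∀ s ∈ Set.Icc 1 t, ‖P s‖ ≤ p
  norm_B_le : ∀ s ∈ Set.Icc 1 t, ‖B s‖ ≤ b
  measurable_Q : ∀ χ : ℝ → L2, AEStronglyMeasurable χ (volume.restrict (Set.Icc 1 t)) →
    AEStronglyMeasurable (fun s => Q s (χ s)) (volume.restrict (Set.Icc 1 t))
  measurable_P : ∀ χ : ℝ → L2, AEStronglyMeasurable χ (volume.restrict (Set.Icc 1 t)) →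
    AEStronglyMeasurable (fun s => P s (χ s)) (volume.restrict (Set.Icc 1 t))
  measurable_B : ∀ χ : ℝ → L2, AEStronglyMeasurable χ (volume.restrict (Set.Icc 1 t)) →
    AEStronglyMeasurable (fun s => B s (χ s)) (volume.restrict (Set.Icc 1 t))

namespace DysonData

variable {R m : ℝ} {V : ℝ → R3 → ℝ} {t q p b : ℝ}

/-- The `n`-th term of the Dyson series without its sign, as a function of the final time. -/
def term (d : DysonData R m V t q p b) (ψ : L2) : ℕ → ℝ → L2
  | 0, s => d.Q s (d.P 1 ψ)
  | n + 1, s => d.Q s (∫ r in (1 : ℝ)..s, d.P r (d.B r (term d ψ n r)))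

theorem integrableOn_of_bounded {t : ℝ} {χ : ℝ → L2}
    (hχ : AEStronglyMeasurable χ (volume.restrict (Set.Icc 1 t))) {c : ℝ}
    (hb : ∀ s ∈ Set.Icc 1 t, ‖χ s‖ ≤ c) : IntegrableOn χ (Set.Icc 1 t) :=
  IntegrableOn.of_bound (by simp) hχ c (ae_restrict_of_forall_mem measurableSet_Icc hb)

/-- Measurability and bound go together in one induction, as the bound gives integrability for the
next step. Integrating `(r-1)ⁿ/n!` produces the next factorial. -/
theorem term_spec (d : DysonData R m V t q p b) (hq : 0 ≤ q) (hp : 0 ≤ p) (hb : 0 ≤ b)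
    (ψ : L2) (n : ℕ) :
    AEStronglyMeasurable (d.term ψ n) (volume.restrict (Set.Icc 1 t)) ∧
    ∀ s ∈ Set.Icc 1 t,
      ‖d.term ψ n s‖ ≤ (q * p) ^ (n + 1) * b ^ n * ‖ψ‖ * ((s - 1) ^ n / n.factorial) := by
  induction n with
  | zero =>
    refine ⟨d.measurable_Q _ aestronglyMeasurable_const, fun s hs => ?_⟩
    have h1 : (1 : ℝ) ∈ Set.Icc 1 t := ⟨le_rfl, hs.1.trans hs.2⟩
    have h2 := (d.P 1).le_of_opNorm_le (d.norm_P_le 1 h1) ψ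
    have h3 := (d.Q s).le_of_opNorm_le (d.norm_Q_le s hs) (d.P 1 ψ)
    simp only [term, zero_add, pow_one, pow_zero, Nat.factorial_zero, Nat.cast_one, div_one, mul_one]
    nlinarith
  | succ n ih =>
    obtain ⟨ihm, ihb⟩ := ih
    set c := (q * p) ^ (n + 1) * b ^ n * ‖ψ‖ with hc
    have hm := d.measurable_P _ (d.measurable_B _ ihm)
    have hle : ∀ r ∈ Set.Icc 1 t, ‖d.P r (d.B r (d.term ψ n r))‖ ≤
        p * b * c * ((r - 1) ^ n / n.factorial) := fun r hr => by
      have h1 := (d.B r).le_of_opNorm_le (d.norm_B_le r hr) (d.term ψ n r)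
      have h2 := (d.P r).le_of_opNorm_le (d.norm_P_le r hr) (d.B r (d.term ψ n r))
      have h3 := ihb r hr
      calc _ ≤ p * (b * (c * ((r - 1) ^ n / n.factorial))) := by
            refine h2.trans ?_
            gcongr
            refine h1.trans ?_
            gcongr
        _ = _ := by ring
    have hI : IntegrableOn (fun r => d.P r (d.B r (d.term ψ n r))) (Set.Icc 1 t) := by
      refine integrableOn_of_bounded hm (c := p * b * c * ((t - 1) ^ n / n.factorial))
        fun r hr => (hle r hr).trans ?_
      have : 0 ≤ r - 1 := by linarith [hr.1]
      gcongr
      exact hr.2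
    -- Because `Q s` stands outside the integral, the integrand does not depend on `s` and the
    -- integral is a continuous primitive; no joint measurability in `(s,r)` is required.
    have hm2 : AEStronglyMeasurable (fun s => ∫ r in (1 : ℝ)..s, d.P r (d.B r (d.term ψ n r)))
        (volume.restrict (Set.Icc 1 t)) := by
      rcases lt_or_ge t 1 with h | h
      · rw [Set.Icc_eq_empty h.not_ge, Measure.restrict_empty]
        exact aestronglyMeasurable_zero_measure _
      · rw [← Set.uIcc_of_le h] at hI ⊢
        exact (intervalIntegral.continuousOn_primitive_interval hI).aestronglyMeasurable
          measurableSet_uIcc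
    refine ⟨d.measurable_Q _ hm2, fun s hs => ?_⟩
    have h3 := (d.Q s).le_of_opNorm_le (d.norm_Q_le s hs)
      (∫ r in (1 : ℝ)..s, d.P r (d.B r (d.term ψ n r)))
    have h4 : ‖∫ r in (1 : ℝ)..s, d.P r (d.B r (d.term ψ n r))‖ ≤
        ∫ r in (1 : ℝ)..s, p * b * c * ((r - 1) ^ n / n.factorial) :=
      intervalIntegral.norm_integral_le_of_norm_le hs.1
        (.of_forall fun r hr => hle r ⟨hr.1.le, hr.2.trans hs.2⟩)
        (Continuous.intervalIntegrable (by fun_prop) _ _)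
    have h5 : ∫ r in (1 : ℝ)..s, p * b * c * ((r - 1) ^ n / n.factorial) =
        p * b * c * ((s - 1) ^ (n + 1) / (n + 1).factorial) := by
      rw [intervalIntegral.integral_const_mul, intervalIntegral.integral_div,
        intervalIntegral.integral_comp_sub_right (fun x => x ^ n) 1, integral_pow,
        Nat.factorial_succ]
      push_cast
      rw [sub_self, zero_pow n.succ_ne_zero, sub_zero, div_div]
    rw [h5] at h4
    calc ‖d.term ψ (n + 1) s‖ ≤ q * (p * b * c * ((s - 1) ^ (n + 1) / (n + 1).factorial)) :=
          h3.trans (by gcongr)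
      _ = _ := by rw [hc]; ring

theorem intervalIntegrable_term (d : DysonData R m V t q p b) (hq : 0 ≤ q)
    (hp : 0 ≤ p) (hb : 0 ≤ b) (ψ : L2) (n : ℕ) {s : ℝ}
    (hs : s ∈ Set.Icc 1 t) :
    IntervalIntegrable (fun r => d.P r (d.B r (d.term ψ n r))) volume 1 s := by
  obtain ⟨hm, hle⟩ := d.term_spec hq hp hb ψ n
  set c := (q * p) ^ (n + 1) * b ^ n * ‖ψ‖ with hc
  have hI : IntegrableOn (fun r => d.P r (d.B r (d.term ψ n r))) (Set.Icc 1 t) := by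
    refine integrableOn_of_bounded (d.measurable_P _ (d.measurable_B _ hm))
      (c := p * (b * (c * ((t - 1) ^ n / n.factorial)))) fun r hr => ?_
    have h1 := (d.B r).le_of_opNorm_le (d.norm_B_le r hr) (d.term ψ n r)
    have h2 := (d.P r).le_of_opNorm_le (d.norm_P_le r hr) (d.B r (d.term ψ n r))
    refine h2.trans ?_
    gcongr
    refine h1.trans ?_
    gcongr
    refine (hle r hr).trans ?_
    have : 0 ≤ r - 1 := by linarith [hr.1]
    gcongr
    exact hr.2
  rw [intervalIntegrable_iff_integrableOn_Icc_of_le hs.1]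
  exact hI.mono_set (Set.Icc_subset_Icc_right hs.2)

theorem step_eq (d : DysonData R m V t q p b) (A : L2 →L[ℝ] L2) {s r : ℝ}
    (hs : s ∈ Set.Icc 1 t) (hr : r ∈ Set.Icc 1 t) :
    (fun χ => A (freeHat R m s r (potentialHat R m V r χ))) =
      ⇑(A ∘L d.Q s ∘L d.P r ∘L d.B r) := by
  ext1 χ
  rw [d.freeHat_eq s hs r hr, d.potentialHat_eq r hr]
  rfl

/-- `dysonIntegral` accumulates operators from the left in `A`, while `term` recurses on the final
time. The induction runs over all bounded `A`, which is pulled out of the Bochner integral. -/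
theorem dysonIntegral_eq (d : DysonData R m V t q p b) (hq : 0 ≤ q)
    (hp : 0 ≤ p) (hb : 0 ≤ b) (ψ : L2) (n : ℕ)
    (A : L2 →L[ℝ] L2) {s : ℝ} (hs : s ∈ Set.Icc 1 t) :
    dysonIntegral R m V ψ n A s = A (d.term ψ n s) := by
  induction n generalizing A s with
  | zero =>
    have h1 : (1 : ℝ) ∈ Set.Icc 1 t := ⟨le_rfl, hs.1.trans hs.2⟩
    rw [dysonIntegral, d.freeHat_eq s hs 1 h1, term]
  | succ n ih =>
    have e : ∀ r ∈ Set.uIcc 1 s, dysonIntegral R m V ψ n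
        (fun χ => A (freeHat R m s r (potentialHat R m V r χ))) r =
        (A ∘L d.Q s) (d.P r (d.B r (d.term ψ n r))) := fun r hr => by
      rw [Set.uIcc_of_le hs.1] at hr
      have hr' : r ∈ Set.Icc 1 t := ⟨hr.1, hr.2.trans hs.2⟩
      rw [d.step_eq A hs hr', ih _ hr']
      rfl
    rw [dysonIntegral, intervalIntegral.integral_congr e,
      ContinuousLinearMap.intervalIntegral_comp_comm _
        (d.intervalIntegrable_term hq hp hb ψ n hs)]
    rfl

theorem dysonIntegrable (d : DysonData R m V t q p b) (hq : 0 ≤ q)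
    (hp : 0 ≤ p) (hb : 0 ≤ b) (ψ : L2) (n : ℕ)
    (A : L2 →L[ℝ] L2) {s : ℝ} (hs : s ∈ Set.Icc 1 t) : DysonIntegrable R m V ψ n A s := by
  induction n generalizing A s with
  | zero => trivial
  | succ n ih =>
    constructor
    · refine IntervalIntegrable.congr (f := fun r => (A ∘L d.Q s) (d.P r (d.B r (d.term ψ n r))))
        (fun r hr => ?_) ?_
      · rw [Set.uIoc_of_le hs.1] at hr
        have hr' : r ∈ Set.Icc 1 t := ⟨hr.1.le, hr.2.trans hs.2⟩
        simp only []
        rw [d.step_eq A hs hr', d.dysonIntegral_eq hq hp hb ψ n _ hr']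
        rfl
      · have hI := d.intervalIntegrable_term hq hp hb ψ n hs
        exact ⟨(A ∘L d.Q s).integrable_comp hI.1, (A ∘L d.Q s).integrable_comp hI.2⟩
    · intro r hr
      have hr' : r ∈ Set.Icc 1 t := ⟨hr.1, hr.2.trans hs.2⟩
      rw [d.step_eq A hs hr']
      exact ih _ hr'

theorem term_add (d : DysonData R m V t q p b) (hq : 0 ≤ q)
    (hp : 0 ≤ p) (hb : 0 ≤ b) (ψ φ : L2) (n : ℕ) {s : ℝ}
    (hs : s ∈ Set.Icc 1 t) : d.term (ψ + φ) n s = d.term ψ n s + d.term φ n s := by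
  induction n generalizing s with
  | zero => simp [term]
  | succ n ih =>
    rw [term, term, term, ← map_add, ← intervalIntegral.integral_add
      (d.intervalIntegrable_term hq hp hb ψ n hs) (d.intervalIntegrable_term hq hp hb φ n hs)]
    congr 1
    refine intervalIntegral.integral_congr fun r hr => ?_
    rw [Set.uIcc_of_le hs.1] at hr
    beta_reduce
    rw [ih ⟨hr.1, hr.2.trans hs.2⟩, map_add, map_add]

theorem term_smul (d : DysonData R m V t q p b) (c : ℝ) (ψ : L2) (n : ℕ) {s : ℝ}
    (hs : s ∈ Set.Icc 1 t) :
    d.term (c • ψ) n s = c • d.term ψ n s := by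
  induction n generalizing s with
  | zero => simp [term]
  | succ n ih =>
    rw [term, term, ← map_smul, ← intervalIntegral.integral_smul]
    congr 1
    refine intervalIntegral.integral_congr fun r hr => ?_
    rw [Set.uIcc_of_le hs.1] at hr
    beta_reduce
    rw [ih ⟨hr.1, hr.2.trans hs.2⟩, map_smul, map_smul]

theorem exists_dysonTerm (d : DysonData R m V t q p b) (hq : 0 ≤ q)
    (hp : 0 ≤ p) (hb : 0 ≤ b) (ht : 1 ≤ t) (n : ℕ) :
    ∃ T : L2 →L[ℝ] L2, (∀ ψ, T ψ = dysonTerm R m V n t ψ) ∧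
      ‖T‖ ≤ (q * p) ^ (n + 1) * b ^ n * ((t - 1) ^ n / n.factorial) := by
  have hs : t ∈ Set.Icc 1 t := ⟨ht, le_rfl⟩
  have h0 : 0 ≤ t - 1 := by linarith
  have hle : ∀ ψ, ‖d.term ψ n t‖ ≤
      (q * p) ^ (n + 1) * b ^ n * ((t - 1) ^ n / n.factorial) * ‖ψ‖ := fun ψ =>
    ((d.term_spec hq hp hb ψ n).2 t hs).trans (le_of_eq (by ring))
  let L : L2 →L[ℝ] L2 := LinearMap.mkContinuous
    { toFun := fun ψ => d.term ψ n t
      map_add' := fun ψ φ => d.term_add hq hp hb ψ φ n hs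
      map_smul' := fun c ψ => d.term_smul c ψ n hs } _ hle
  refine ⟨(-1 : ℝ) ^ n • L, fun ψ => ?_, ?_⟩
  · rw [dysonTerm, ← ContinuousLinearMap.coe_id' (R₁ := ℝ) (M₁ := L2),
      d.dysonIntegral_eq hq hp hb ψ n _ hs]
    rfl
  · rw [norm_smul, norm_pow, norm_neg, norm_one, one_pow, one_mul]
    exact LinearMap.mkContinuous_norm_le _ (by positivity) _

end DysonData

/-! ### Summation of the series and uniform constants -/

theorem hasSum_exp_bound (Λ τ : ℝ) :
    HasSum (fun n : ℕ => Λ ^ (n + 1) * τ ^ n / (n.factorial : ℝ)) (Λ * Real.exp (Λ * τ)) := by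
  have h := (NormedSpace.expSeries_div_hasSum_exp (Λ * τ)).mul_left Λ
  rw [← Real.exp_eq_exp_ℝ] at h
  refine h.congr_fun fun n => ?_
  rw [mul_pow]
  ring

theorem exists_hasSum_of_norm_le {T : ℕ → L2 →L[ℝ] L2} {Λ τ : ℝ}
    (h : ∀ n, ‖T n‖ ≤ Λ ^ (n + 1) * τ ^ n / (n.factorial : ℝ)) :
    ∃ U, HasSum T U ∧ ‖U‖ ≤ Λ * Real.exp (Λ * τ) := by
  have hs := hasSum_exp_bound Λ τ
  have hT : Summable T := .of_norm_bounded hs.summable h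
  exact ⟨_, hT.hasSum, tsum_of_norm_bounded hs h⟩

theorem exists_dysonData {R m : ℝ} (C : ℝ) (hR : 0 < R) (hmR : 3 / 2 < m * R) :
    ∃ c b : ℝ, 0 < c ∧ 0 ≤ b ∧ ∀ t : ℝ, 1 ≤ t → ∀ V : ℝ → R3 → ℝ,
      AEStronglyMeasurable (fun p : ℝ × R3 => V p.1 p.2)
        (volume.restrict (Set.Icc 1 t ×ˢ Set.univ)) →
      (∀ s ∈ Set.Icc 1 t, ∃ g : R3 → ℂ,
        FunHasFourierTransform (V s) g ∧ Integrable g ∧ ∫ k, ‖g k‖ ≤ C) →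
      Nonempty (DysonData R m V t (c * t ^ 2) c b) := by
  obtain ⟨c, hc, hT⟩ := exists_norm_transOp_le hmR
  -- Both constants are fixed before `t` and `V`. The maximum with `0` keeps the second one
  -- nonnegative for every real `C`.
  refine ⟨c, ‖momentumOp R m‖ * ((‖fourierFactor‖ * max C 0) * ‖fieldOp R m‖), hc, by positivity,
    fun t ht V hVm hV => ?_⟩
  have hbd : ∀ s ∈ Set.Icc 1 t, MemLp (fun x => (V s x : ℂ)) ∞ ∧
      ‖mulOp (fun x => (V s x : ℂ))‖ ≤ ‖fourierFactor‖ * max C 0 := fun s hs => by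
    obtain ⟨g, hg, hgi, hgC⟩ := hV s hs
    have h1 : ∀ᵐ x, ‖(V s x : ℂ)‖ ≤ ‖fourierFactor‖ * max C 0 := by
      filter_upwards [hg.ae_norm_le hgi] with x hx
      refine hx.trans ?_
      gcongr
      exact hgC.trans (le_max_left _ _)
    exact ⟨memLp_top_of_ae_norm_le hg.aestronglyMeasurable h1,
      norm_mulOp_le (by positivity) h1⟩
  have hge : ∀ᵐ s ∂(volume.restrict (Set.Icc 1 t)), (1 : ℝ) ≤ s :=
    ae_restrict_of_forall_mem measurableSet_Icc fun s hs => hs.1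
  have h11 : ∀ᵐ s ∂(volume.restrict (Set.Icc 1 t)), (1 : ℝ) ≤ 1 := .of_forall fun _ => le_rfl
  have hVm' : AEStronglyMeasurable (fun p : ℝ × R3 => (V p.1 p.2 : ℂ))
      ((volume.restrict (Set.Icc 1 t)).prod volume) := by
    have h1 : (volume : Measure (ℝ × R3)).restrict (Set.Icc 1 t ×ˢ Set.univ) =
        (volume.restrict (Set.Icc 1 t)).prod volume := by
      rw [Measure.volume_eq_prod, ← Measure.prod_restrict, Measure.restrict_univ]
    rw [← h1]
    exact Complex.continuous_ofReal.comp_aestronglyMeasurable hVm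
  exact ⟨
    { Q := fun s => transOp R m 1 s
      P := fun s => transOp R m s 1
      B := fun s => momentumOp R m ∘L
        (mulOp (fun x => (V s x : ℂ))).restrictScalars ℝ ∘L fieldOp R m
      freeHat_eq := fun s hs r hr ψ => freeHat_eq hR hmR hs.1 hr.1 ψ
      potentialHat_eq := fun r hr ψ => potentialHat_eq hR hmR (hbd r hr).1 ψ
      norm_Q_le := fun s hs => (hT 1 s le_rfl hs.1).trans (by
        have := hs.1
        gcongr
        exact hs.2)
      norm_P_le := fun s hs => (hT s 1 hs.1 le_rfl).trans (by simp)
      norm_B_le := fun s hs => by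
        refine (ContinuousLinearMap.opNorm_comp_le _ _).trans ?_
        gcongr
        refine (ContinuousLinearMap.opNorm_comp_le _ _).trans ?_
        rw [ContinuousLinearMap.norm_restrictScalars]
        gcongr
        exact (hbd s hs).2
      measurable_Q := fun χ hχ => aestronglyMeasurable_transOp hmR (ρ := fun _ => 1)
        (σ := fun s => s) measurable_const measurable_id h11 hge hχ
      measurable_P := fun χ hχ => aestronglyMeasurable_transOp hmR (ρ := fun s => s)
        (σ := fun _ => 1) measurable_id measurable_const hge h11 hχ
      measurable_B := fun χ hχ => (momentumOp R m).continuous.comp_aestronglyMeasurable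
        (aestronglyMeasurable_mulOp (a := fun s x => (V s x : ℂ)) hVm'
          (ae_restrict_of_forall_mem measurableSet_Icc fun s hs => (hbd s hs).1)
          ((fieldOp R m).continuous.comp_aestronglyMeasurable hχ)) }⟩

end DeSitter

end

theorem theorem1 (R m C : ℝ) (hR : 0 < R) (hmR : 3 / 2 < m * R) :
    ∃ Λ : ℝ, 0 < Λ ∧ ∀ (t : ℝ), 1 ≤ t → ∀ (V : ℝ → DeSitter.R3 → ℝ),
      AEStronglyMeasurable (fun p : ℝ × DeSitter.R3 => V p.1 p.2)
        (volume.restrict (Set.Icc 1 t ×ˢ Set.univ)) →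
      (∀ s ∈ Set.Icc 1 t, ∃ g : DeSitter.R3 → ℂ,
        DeSitter.FunHasFourierTransform (V s) g ∧ Integrable g ∧ ∫ k, ‖g k‖ ≤ C) →
      -- the maps `K_s` and the perturbation `V(s)` are well defined, and `K_s` is invertible
      (∀ s ∈ Set.Icc 1 t,
        (∀ D, DeSitter.IsCoefficient R m s D (DeSitter.coefficientMap R m s D)) ∧
        Function.Bijective (DeSitter.coefficientMap R m s) ∧
        (∀ D, DeSitter.IsPotentialImage (V s) D (DeSitter.potentialMap (V s) D))) ∧
      -- the iterated integrals converge
      (∀ (n : ℕ) (ψ : DeSitter.L2), DeSitter.DysonIntegrable R m V ψ n id t) ∧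
      -- the terms are bounded operators, and the series converges in operator norm
      ∃ (T : ℕ → DeSitter.L2 →L[ℝ] DeSitter.L2) (U : DeSitter.L2 →L[ℝ] DeSitter.L2),
        (∀ n ψ, T n ψ = DeSitter.dysonTerm R m V n t ψ) ∧
        (∀ n, ‖T n‖ ≤ (Λ * t ^ 3) ^ (n + 1) * (t - 1) ^ n / (n.factorial : ℝ)) ∧
        HasSum T U ∧
        ‖U‖ ≤ Λ * t ^ 3 * Real.exp (Λ * t ^ 3 * (t - 1)) := by
  obtain ⟨c, b, hc, hb, hd⟩ := DeSitter.exists_dysonData C hR hmR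
  -- Each of the `n + 1` free evolutions costs `c² t²`. Using `1 + b` instead of `b` lets `bⁿ` be
  -- absorbed into an `(n+1)`-st power and keeps `Λ` positive when `b = 0`.
  refine ⟨c ^ 2 * (1 + b), by positivity, fun t ht V hVm hV => ?_⟩
  obtain ⟨d⟩ := hd t ht V hVm hV
  have ht' : t ∈ Set.Icc 1 t := ⟨ht, le_rfl⟩
  have ht0 : 0 < t := by linarith
  have hτ : 0 ≤ t - 1 := by linarith
  have hq : 0 ≤ c * t ^ 2 := by positivity
  refine ⟨fun s hs => ⟨DeSitter.isCoefficient_coefficientMap hmR hs.1,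
    DeSitter.bijective_coefficientMap hR hmR hs.1, fun D => ?_⟩,
    fun n ψ => d.dysonIntegrable hq hc.le hb ψ n (ContinuousLinearMap.id ℝ _) ht', ?_⟩
  · obtain ⟨g, hg, hgi, -⟩ := hV s hs
    exact DeSitter.isPotentialImage_potentialMap
      (memLp_top_of_bound hg.aestronglyMeasurable _ (hg.ae_norm_le hgi)) D
  · choose T hT hTn using d.exists_dysonTerm hq hc.le hb ht
    have hle : ∀ n, ‖T n‖ ≤ (c ^ 2 * (1 + b) * t ^ 3) ^ (n + 1) * (t - 1) ^ n /
        (n.factorial : ℝ) := fun n => by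
      refine (hTn n).trans ?_
      rw [mul_div_assoc]
      refine mul_le_mul_of_nonneg_right ?_ (by positivity)
      have h1 : c * t ^ 2 * c ≤ c ^ 2 * t ^ 3 := by
        have : t ^ 2 ≤ t ^ 3 := pow_le_pow_right₀ ht (by norm_num)
        nlinarith [sq_nonneg c]
      have h2 : b ^ n ≤ (1 + b) ^ (n + 1) := by
        refine (pow_le_pow_left₀ hb (show b ≤ 1 + b by linarith) n).trans ?_
        exact pow_le_pow_right₀ (by linarith) n.le_succ
      calc (c * t ^ 2 * c) ^ (n + 1) * b ^ n ≤ (c ^ 2 * t ^ 3) ^ (n + 1) * (1 + b) ^ (n + 1) := by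
            gcongr
        _ = _ := by rw [← mul_pow]; ring
    obtain ⟨U, hU, hUn⟩ := DeSitter.exists_hasSum_of_norm_le hle
    exact ⟨T, U, hT, hle, hU, hUn⟩
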